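/- **Setting.** A discrete filtered set (d.f.s.) is a family $\Omega=(\Omega_L)_{L\ge 0}$ of finite subsets of $\mathbb C$, increasing in $L$, with $\Omega_\delta=\emptyset$ for some $\delta>0$. Put $\rho(\Omega)=\sup\{\rho\ge0\mid\Omega_\rho=\emptyset\}\in(0,\infty]$, $D_{\rho}=\{|\xi|<\rho\}$, $(\Omega*\Omega')_L=\{\omega_1+\omega_2\mid \omega_1\in\Omega_{L_1},\,\omega_2\in\Omega'_{L_2},\,L_1+L_2=L\}\cup\Omega_L\cup\Omega'_L$, and let $\Omega^{*w}$ be the $w$-fold sum. An $\Omega$-allowed path is a Lipschitz path $\gamma:[0,1]\to\mathbb C$ with $\gamma(0)=0$ such that, for all $t$, the point $(\text{length of }\gamma|_{[0,t]},\gamma(t))$ lies outside the closure in $\mathbb R_{\ge0}\times\mathbb C$ of $\{(\lambda,\omega)\mid\omega\in\Omega_\lambda\}$. An $\Omega$-endless Riemann surface is a connected Riemann surface with a local biholomorphism to $\mathbb C$ and a base point over $0$ such that all $\Omega$-allowed paths lift from the base point; $(X_\Omega,\mathfrak p_\Omega,\underline 0_\Omega)$ denotes the initial object of the category of $\Omega$-endless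 Riemann surfaces (morphisms are the local biholomorphisms compatible with the projections and base points). $\hat{\mathscr R}_\Omega$ is the set of germs in $\mathbb C\{\xi\}$ that can be analytically continued along all $\Omega$-allowed paths, and $\mathfrak p_\Omega^*\hat\varphi$ is the holomorphic function on $X_\Omega$ that equals $\hat\varphi\circ\mathfrak p_\Omega$ near $\underline 0_\Omega$. An iteration diagram $T=(V,E)$ is a finite directed tree in which every vertex has at most one outgoing edge. Let $\hat v$ be its root (the vertex that can be reached from all vertices), $V^\circ=V\setminus\{\hat v\}$, $k=|V|$, $V_v^1=\{u\mid u\to v\}$; a leaf is a vertex without incoming edge, and $w_v$ is the number of leaves from which $v$ can be reached. Put $\Omega_v=\Omega^{*w_v}$ and $X_\Omega^T=\prod_{v\in V}X_{\Omega_v}$. For $|\xi|<\rho(\Omega)$ let $\mathscr L_v(\xi)\in X_{\Omega_v}$ be the end point of the lift of $t\mapsto t\xi$, and let $\mathscr D(\xi)(\vec s)=(\mathscr L_v(s_v\xi))_{v\in V}\in X_\Omega^T$ for $\vec s$ in a neighbourhood in $\mathbb R^V$ of $$\Delta_T=\Big\{(s_v)_{v\in V}\in\mathbb R_{\ge0}^V\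 \Big|\ \sum_{u\in V_v^1}s_u\le s_v\ (v\in V),\ s_{\hat v}=1\Big\}.$$ $[\Delta_T]$ is the integration current of $\Delta_T$, oriented so that $\int_{\Delta_T}\bigwedge_{v\in V^\circ}ds_v>0$, for a fixed order of $V^\circ$. **Proposition 3.7.** Let $\Omega$ be a d.f.s., $T=(V,E)$ an iteration diagram, $\hat f_v$ entire functions and $\hat\varphi_v\in\hat{\mathscr R}_{\Omega_v}$ ($v\in V$). Let $\hat\psi_T=\hat\psi_{\hat v}$ be the iterated convolution, where the germs $\hat\psi_v$ at $0$ are defined, starting from the leaves, by $$\hat\psi_v=\hat\varphi_v\cdot\Big(\hat f_v*\prod^{*}_{u\in V_v^1}\hat\psi_u\Big)\qquad(v\in V),\qquad (f*g)(\xi)=\int_0^\xi f(\xi-\xi')g(\xi')\,d\xi',$$ $\prod^*$ being the convolution product, equal to the unit $\delta$ when $v$ is a leaf. Then the functions $\mathfrak p_{\Omega_v}^*\hat\varphi_v$ exist, and with $\xi_v=\mathfrak p_{\Omega_v}(\underline\xi_v)$ and the same order of $V^\circ$ as above, $$\beta_T=\Big(\prod_{v\in V}(\mathfrak p_{\Omega_v}^*\hat\varphi_v)(\underline\xi_v)\,\hat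 f_v\big(\xi_v-\sum_{u\in V_v^1}\xi_u\big)\Big)\bigwedge_{v\in V^\circ}d\underline\xi_v$$ is a holomorphic $(k-1)$-form on $X_\Omega^T$, where $\bigwedge_{v\in V^\circ} d\underline\xi_v$ is the pull-back of $\bigwedge_{v\in V^\circ} d\xi_v$ by $(\mathfrak p_{\Omega_v})_{v\in V}:X_\Omega^T\to\mathbb C^V$. The germ $\hat\psi_T$ extends to a holomorphic function on $D_{\rho(\Omega)}$, still denoted $\hat\psi_T$; for every $\xi\in D_{\rho(\Omega)}$ the coefficient of the pulled-back form $\mathscr D(\xi)^*\beta_T$ is integrable over $\Delta_T$, and $$\hat\psi_T(\xi)=\mathscr D(\xi)_\#[\Delta_T](\beta_T)=\int_{\Delta_T}\mathscr D(\xi)^*\beta_T .$$ -/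

import Mathlib

open Set Filter Topology unitInterval
open scoped NNReal ENNReal Manifold ContDiff

noncomputable section

namespace Resurgence

/-! ### Discrete filtered sets -/

/-- A discrete filtered set (d.f.s.): an increasing family of finite subsets of `ℂ` indexed by
`ℝ≥0`, which is empty for some positive index. -/
structure DFS where
  toFun : ℝ≥0 → Set ℂ
  finite' : ∀ l, (toFun l).Finite
  mono' : ∀ l₁ l₂, l₁ ≤ l₂ → toFun l₁ ⊆ toFun l₂
  empty' : ∃ δ : ℝ≥0, 0 < δ ∧ toFun δ = ∅

namespace DFS

instance : CoeFun DFS fun _ => ℝ≥0 → Set ℂ := ⟨DFS.toFun⟩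

/-- The trivial d.f.s. -/
def trivial : DFS where
  toFun _ := ∅
  finite' _ := Set.finite_empty
  mono' _ _ _ := le_rfl
  empty' := ⟨1, one_pos, rfl⟩

/-- The sum `Ω * Ω'` of two d.f.s. -/
def sum (Ω Ω' : DFS) : DFS where
  toFun l := {z | ∃ l₁ l₂ : ℝ≥0, l₁ + l₂ = l ∧ ∃ a ∈ Ω l₁, ∃ b ∈ Ω' l₂, a + b = z} ∪ Ω l ∪ Ω' l
  finite' l := by
    refine ((Set.Finite.subset ((Ω.finite' l).image2 (· + ·) (Ω'.finite' l)) ?_).union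
      (Ω.finite' l)).union (Ω'.finite' l)
    rintro z ⟨l₁, l₂, h, a, ha, b, hb, rfl⟩
    exact ⟨a, Ω.mono' _ _ (h ▸ le_self_add) ha, b, Ω'.mono' _ _ (h ▸ le_add_self) hb, rfl⟩
  mono' l l' h := by
    rintro z ((⟨l₁, l₂, rfl, a, ha, b, hb, rfl⟩ | hz) | hz)
    · refine Or.inl (Or.inl ⟨l₁, l' - l₁, ?_, a, ha, b, Ω'.mono' _ _ ?_ hb, rfl⟩)
      · exact add_tsub_cancel_of_le (le_self_add.trans h)
      · exact le_tsub_of_add_le_left h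
    · exact Or.inl (Or.inr (Ω.mono' _ _ h hz))
    · exact Or.inr (Ω'.mono' _ _ h hz)
  empty' := by
    obtain ⟨δ, hδ, h⟩ := Ω.empty'
    obtain ⟨δ', hδ', h'⟩ := Ω'.empty'
    have key : ∀ l ≤ min δ δ', Ω l = ∅ ∧ Ω' l = ∅ := fun l hl =>
      ⟨Set.subset_empty_iff.1 (h ▸ Ω.mono' _ _ (hl.trans (min_le_left _ _))),
        Set.subset_empty_iff.1 (h' ▸ Ω'.mono' _ _ (hl.trans (min_le_right _ _)))⟩
    refine ⟨min δ δ', lt_min hδ hδ', Set.eq_empty_iff_forall_notMem.2 ?_⟩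
    rintro z ((⟨l₁, l₂, hl, a, ha, b, hb, rfl⟩ | hz) | hz)
    · rw [(key l₁ (hl ▸ le_self_add)).1] at ha
      exact ha
    · rw [(key _ le_rfl).1] at hz
      exact hz
    · rw [(key _ le_rfl).2] at hz
      exact hz

/-- The `n`-fold sum `Ω * ⋯ * Ω` (trivial for `n = 0`, and `Ω` itself for `n = 1`). -/
def nsum (Ω : DFS) : ℕ → DFS
  | 0 => trivial
  | n + 1 => (nsum Ω n).sum Ω

/-- The distance `ρ(Ω) ∈ [0, ∞]` to a d.f.s. -/
def rho (Ω : DFS) : ℝ≥0∞ := sSup ((fun r : ℝ≥0 => (r : ℝ≥0∞)) '' {r | Ω r = ∅})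

/-- The disc `D_{ρ(Ω)}`, the whole plane if `ρ(Ω) = ∞`. -/
def disc (Ω : DFS) : Set ℂ := {ξ | (‖ξ‖₊ : ℝ≥0∞) < Ω.rho}

/-- `𝒮_Ω`, as a subset of `ℝ≥0 × ℂ`. -/
def S (Ω : DFS) : Set (ℝ≥0 × ℂ) := {x | x.2 ∈ Ω x.1}

/-- `ℳ_Ω`, the complement of the closure of `𝒮_Ω` in `ℝ≥0 × ℂ`. -/
def M (Ω : DFS) : Set (ℝ≥0 × ℂ) := (closure Ω.S)ᶜ

end DFS

/-! ### Allowed paths -/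

/-- The length `L(γ_{|t})` of the restriction of a (Lipschitz) path to `[0, t]`. -/
def pathLength (γ : I → ℂ) (t : I) : ℝ≥0 := (eVariationOn γ (Iic t)).toNNReal

/-- `Ω`-allowed paths: Lipschitz paths starting at `0` with
`(L(γ_{|t}), γ(t)) ∈ ℳ_Ω` for all `t ∈ [0, 1]`. -/
structure IsAllowed (Ω : DFS) (γ : I → ℂ) : Prop where
  lipschitz : ∃ K : ℝ≥0, LipschitzWith K γ
  zero : γ 0 = 0
  mem : ∀ t, (pathLength γ t, γ t) ∈ Ω.M

/-- The set `Π_Ω` of `Ω`-allowed paths. -/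
abbrev AllowedPath (Ω : DFS) : Type := {γ : I → ℂ // IsAllowed Ω γ}

/-! ### Endless Riemann surfaces -/

/-- An `Ω`-endless Riemann surface: a connected Riemann surface `X` with a local biholomorphism
`𝔭 : X → ℂ` and a base point over `0` such that every `Ω`-allowed path has a lift to `X` starting
at the base point. (Connected Riemann surfaces have the cardinality of the continuum, so that
nothing is lost by asking the underlying set to live in `Type`.) -/
structure EndlessSurface (Ω : DFS) where
  carrier : Type
  [topology : TopologicalSpace carrier]
  [charted : ChartedSpace ℂ carrier]
  [manifold : IsManifold 𝓘(ℂ, ℂ) ω carrier]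
  [t2 : T2Space carrier]
  [connected : ConnectedSpace carrier]
  proj : carrier → ℂ
  proj_localBihol : IsLocalDiffeomorph 𝓘(ℂ, ℂ) 𝓘(ℂ, ℂ) ω proj
  base : carrier
  proj_base : proj base = 0
  exists_lift : ∀ γ : I → ℂ, IsAllowed Ω γ →
    ∃ c : I → carrier, Continuous c ∧ c 0 = base ∧ ∀ t, proj (c t) = γ t

namespace EndlessSurface

variable {Ω : DFS}

attribute [instance] topology charted manifold t2 connected

instance : CoeSort (EndlessSurface Ω) Type := ⟨carrier⟩

/-- The lift of an allowed path to an endless Riemann surface. -/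
def lift (X : EndlessSurface Ω) (γ : AllowedPath Ω) : I → X :=
  (X.exists_lift γ.1 γ.2).choose

/-- The end point of the lift of an allowed path. -/
def endpoint (X : EndlessSurface Ω) (γ : AllowedPath Ω) : X := X.lift γ 1

/-- A morphism of endless Riemann surfaces: a local biholomorphism that commutes with the
projections to `ℂ` and preserves the base points. -/
structure IsMorphism (X Y : EndlessSurface Ω) (q : X → Y) : Prop where
  localBihol : IsLocalDiffeomorph 𝓘(ℂ, ℂ) 𝓘(ℂ, ℂ) ω q
  proj : ∀ x, Y.proj (q x) = X.proj x
  base : q X.base = Y.base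

variable (X : EndlessSurface Ω) (γ : AllowedPath Ω)

lemma continuous_lift : Continuous (X.lift γ) := (X.exists_lift γ.1 γ.2).choose_spec.1
lemma lift_zero : X.lift γ 0 = X.base := (X.exists_lift γ.1 γ.2).choose_spec.2.1
lemma proj_lift (t : I) : X.proj (X.lift γ t) = γ.1 t := (X.exists_lift γ.1 γ.2).choose_spec.2.2 t
lemma isLocalHomeomorph_proj : IsLocalHomeomorph X.proj := X.proj_localBihol.isLocalHomeomorph
lemma continuous_proj : Continuous X.proj := X.isLocalHomeomorph_proj.continuous
lemma isSeparatedMap_proj : IsSeparatedMap X.proj := T2Space.isSeparatedMap _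

/-- Uniqueness of lifts. -/
lemma lift_unique {c : I → X} (hc : Continuous c) (h0 : c 0 = X.base)
    (hp : ∀ t, X.proj (c t) = γ.1 t) : c = X.lift γ :=
  X.isSeparatedMap_proj.eq_of_comp_eq X.isLocalHomeomorph_proj.isLocallyInjective hc
    (X.continuous_lift γ) (by ext t; simp [hp, X.proj_lift]) 0 (by rw [h0, X.lift_zero])

end EndlessSurface

/-! ### Bending and restricting allowed paths -/

/-- The path `γ + t w`, which ends at `γ(1) + w`. -/
def shear (γ : I → ℂ) (w : ℂ) : I → ℂ := fun t => γ t + (t : ℝ) • w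

lemma eVariationOn_add_le (f g : I → ℂ) (s : Set I) :
    eVariationOn (f + g) s ≤ eVariationOn f s + eVariationOn g s := by
  refine iSup_le fun p => ?_
  calc _ ≤ ∑ i ∈ Finset.range p.1, (edist (f (p.2.1 (i + 1))) (f (p.2.1 i)) +
          edist (g (p.2.1 (i + 1))) (g (p.2.1 i))) :=
        Finset.sum_le_sum fun i _ => edist_add_add_le _ _ _ _
    _ ≤ _ := by
      rw [Finset.sum_add_distrib]
      exact add_le_add (eVariationOn.sum_le p.2.2.1 p.2.2.2) (eVariationOn.sum_le p.2.2.1 p.2.2.2)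

lemma eVariationOn_le_of_lipschitz {γ : I → ℂ} {K : ℝ≥0} (h : LipschitzWith K γ) {a b : I}
    (hab : a ≤ b) : eVariationOn γ (Icc a b) ≤ K * ENNReal.ofReal (b - a) := by
  have h1 := (h.lipschitzOnWith (s := univ)).comp_eVariationOn_le (f := γ) (g := id)
    (s := Icc a b) (mapsTo_univ _ _)
  refine h1.trans (mul_le_mul_right ?_ _)
  have h2 := MonotoneOn.eVariationOn_eq (f := fun t : I => (t : ℝ)) (s := Icc a b)
    (fun x _ y _ h => h) (left_mem_Icc.2 hab) (right_mem_Icc.2 hab)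
  rw [inter_self] at h2
  have h3 : eVariationOn (id : I → I) (Icc a b) = eVariationOn (fun t : I => (t : ℝ)) (Icc a b) :=
    rfl
  exact (h3.trans h2).le

lemma Iic_eq_Icc (t : I) : Iic t = Icc 0 t := by
  ext x; simp

lemma eVariationOn_ne_top {γ : I → ℂ} {K : ℝ≥0} (h : LipschitzWith K γ) (t : I) :
    eVariationOn γ (Iic t) ≠ ⊤ := by
  rw [Iic_eq_Icc]
  refine ne_top_of_le_ne_top ?_ (eVariationOn_le_of_lipschitz h (unitInterval.nonneg' (t := t)))
  exact ENNReal.mul_ne_top ENNReal.coe_ne_top ENNReal.ofReal_ne_top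

lemma coe_pathLength {γ : I → ℂ} {K : ℝ≥0} (h : LipschitzWith K γ) (t : I) :
    (pathLength γ t : ℝ≥0∞) = eVariationOn γ (Iic t) :=
  ENNReal.coe_toNNReal (eVariationOn_ne_top h t)

lemma lipschitz_pathLength {γ : I → ℂ} {K : ℝ≥0} (h : LipschitzWith K γ) :
    LipschitzWith K (pathLength γ) := by
  have key : ∀ a b : I, a ≤ b → dist (pathLength γ a) (pathLength γ b) ≤ K * dist a b := by
    intro a b hab
    have h1 := eVariationOn.Icc_add_Icc γ (s := univ) (unitInterval.nonneg' (t := a)) hab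
      (mem_univ _)
    simp only [univ_inter] at h1
    rw [← Iic_eq_Icc, ← Iic_eq_Icc, ← coe_pathLength h, ← coe_pathLength h] at h1
    have h2 := eVariationOn_le_of_lipschitz h hab
    have h3 : (pathLength γ b : ℝ≥0∞) ≤ pathLength γ a + K * (b - a : ℝ).toNNReal := by
      rw [← h1]; exact add_le_add le_rfl h2
    have h3' : pathLength γ b ≤ pathLength γ a + K * (b - a : ℝ).toNNReal := by exact_mod_cast h3
    have h4 : pathLength γ a ≤ pathLength γ b := by
      have : (pathLength γ a : ℝ≥0∞) ≤ pathLength γ b := h1 ▸ le_self_add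
      exact_mod_cast this
    have h5 : (0 : ℝ) ≤ b - a := sub_nonneg.2 hab
    rw [NNReal.dist_eq, abs_sub_comm, abs_of_nonneg (sub_nonneg.2 (by exact_mod_cast h4)),
      dist_comm, Subtype.dist_eq, Real.dist_eq, abs_of_nonneg h5]
    have h6 : (pathLength γ b : ℝ) ≤ pathLength γ a + K * ((b - a : ℝ).toNNReal : ℝ) := by
      exact_mod_cast h3'
    rw [Real.coe_toNNReal _ h5] at h6
    linarith
  refine LipschitzWith.of_dist_le_mul fun a b => ?_
  rcases le_total a b with hab | hab
  · exact key a b hab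
  · rw [dist_comm, dist_comm a]; exact key b a hab

lemma lipschitz_ray (w : ℂ) : LipschitzWith ‖w‖₊ (fun t : I => (t : ℝ) • w) := by
  refine LipschitzWith.of_dist_le_mul fun a b => ?_
  rw [dist_eq_norm, ← sub_smul, norm_smul, Subtype.dist_eq, Real.dist_eq, Real.norm_eq_abs,
    coe_nnnorm, mul_comm]

lemma lipschitz_shear {γ : I → ℂ} {K : ℝ≥0} (h : LipschitzWith K γ) (w : ℂ) :
    LipschitzWith (K + ‖w‖₊) (shear γ w) := h.add (lipschitz_ray w)

lemma shear_shear (γ : I → ℂ) (w w' : ℂ) : shear (shear γ w) w' = shear γ (w + w') := by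
  ext t; simp only [shear, smul_add, add_assoc]

lemma shear_zero (γ : I → ℂ) : shear γ 0 = γ := by
  ext t; simp [shear]

lemma pathLength_shear_le {γ : I → ℂ} {K : ℝ≥0} (h : LipschitzWith K γ) (w : ℂ) (t : I) :
    pathLength (shear γ w) t ≤ pathLength γ t + ‖w‖₊ := by
  have h1 : (pathLength (shear γ w) t : ℝ≥0∞) ≤ pathLength γ t + ‖w‖₊ := by
    rw [coe_pathLength (lipschitz_shear h w), coe_pathLength h]
    refine (eVariationOn_add_le γ (fun t : I => (t : ℝ) • w) _).trans (add_le_add le_rfl ?_)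
    rw [Iic_eq_Icc]
    refine (eVariationOn_le_of_lipschitz (lipschitz_ray w) unitInterval.nonneg').trans ?_
    calc _ ≤ (‖w‖₊ : ℝ≥0∞) * 1 := by
          refine mul_le_mul_right ?_ _
          rw [ENNReal.ofReal_le_one]
          simpa using t.2.2
      _ = _ := mul_one _
  exact_mod_cast h1

lemma dist_shear_le {γ : I → ℂ} {K : ℝ≥0} (h : LipschitzWith K γ) (w : ℂ) (t : I) :
    dist (pathLength (shear γ w) t, shear γ w t) (pathLength γ t, γ t) ≤ ‖w‖ := by
  rw [Prod.dist_eq]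
  refine max_le ?_ ?_
  · have h1 := pathLength_shear_le h w t
    have h2 := pathLength_shear_le (lipschitz_shear h w) (-w) t
    rw [shear_shear, add_neg_cancel, shear_zero, nnnorm_neg] at h2
    rw [NNReal.dist_eq, abs_le]
    have h1' : (pathLength (shear γ w) t : ℝ) ≤ pathLength γ t + ‖w‖ := by exact_mod_cast h1
    have h2' : (pathLength γ t : ℝ) ≤ pathLength (shear γ w) t + ‖w‖ := by exact_mod_cast h2
    constructor <;> linarith
  · simp only [shear, dist_eq_norm, add_sub_cancel_left, norm_smul, Real.norm_eq_abs]
    rw [abs_of_nonneg t.2.1]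
    exact mul_le_of_le_one_left (norm_nonneg _) t.2.2

lemma isOpen_M (Ω : DFS) : IsOpen Ω.M := isClosed_closure.isOpen_compl

lemma eventually_isAllowed_shear {Ω : DFS} {γ : I → ℂ} (h : IsAllowed Ω γ) :
    ∀ᶠ w in 𝓝 (0 : ℂ), IsAllowed Ω (shear γ w) := by
  obtain ⟨K, hK⟩ := h.lipschitz
  have hc : Continuous fun t => (pathLength γ t, γ t) :=
    (lipschitz_pathLength hK).continuous.prodMk hK.continuous
  obtain ⟨δ, hδ, hs⟩ := (isCompact_range hc).exists_thickening_subset_open (isOpen_M Ω)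
    (range_subset_iff.2 h.mem)
  filter_upwards [Metric.ball_mem_nhds (0 : ℂ) hδ] with w hw
  refine ⟨⟨_, lipschitz_shear hK w⟩, by simp [shear, h.zero], fun t => hs ?_⟩
  rw [Metric.mem_thickening_iff]
  exact ⟨_, mem_range_self t, (dist_shear_le hK w t).trans_lt (by simpa using hw)⟩

/-- The restriction of a path to `[0, t]`, reparametrized by `[0, 1]`. -/
def restrict (γ : I → ℂ) (t : I) : I → ℂ := fun s => γ (t * s)

lemma pathLength_restrict (γ : I → ℂ) (t s : I) :
    pathLength (restrict γ t) s = pathLength γ (t * s) := by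
  unfold pathLength
  congr 1
  have hm : Monotone fun s : I => t * s := fun a b hab =>
    Subtype.coe_le_coe.1 (by simpa using mul_le_mul_of_nonneg_left (Subtype.coe_le_coe.2 hab) t.2.1)
  have : eVariationOn (γ ∘ fun s : I => t * s) (Iic s) = _ :=
    eVariationOn.comp_eq_of_monotoneOn γ _ (hm.monotoneOn (Iic s))
  refine this.trans ?_
  congr 1
  ext x
  constructor
  · rintro ⟨y, hy, rfl⟩
    exact hm hy
  · intro hx
    have hx' : (x : ℝ) ≤ t * s := by exact_mod_cast hx
    rcases eq_or_lt_of_le t.2.1 with h0 | h0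
    · refine ⟨0, unitInterval.nonneg', Subtype.ext ?_⟩
      rw [← h0] at hx'
      have := x.2.1
      simp; linarith
    · refine ⟨⟨x / t, div_nonneg x.2.1 t.2.1, ?_⟩, ?_, ?_⟩
      · rw [div_le_one h0]
        exact hx'.trans (mul_le_of_le_one_right t.2.1 s.2.2)
      · change (x : ℝ) / t ≤ s
        rw [div_le_iff₀ h0]; linarith
      · refine Subtype.ext ?_
        simp only [Icc.coe_mul]
        field_simp

lemma isAllowed_restrict {Ω : DFS} {γ : I → ℂ} (h : IsAllowed Ω γ) (t : I) :
    IsAllowed Ω (restrict γ t) := by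
  obtain ⟨K, hK⟩ := h.lipschitz
  refine ⟨⟨K, LipschitzWith.of_dist_le_mul fun a b => (hK.dist_le_mul _ _).trans ?_⟩, ?_, ?_⟩
  · refine mul_le_mul_of_nonneg_left ?_ K.2
    rw [Subtype.dist_eq, Subtype.dist_eq, Real.dist_eq, Real.dist_eq, Icc.coe_mul, Icc.coe_mul,
      ← mul_sub, abs_mul, abs_of_nonneg t.2.1]
    exact mul_le_of_le_one_left (abs_nonneg _) t.2.2
  · simp [restrict, h.zero]
  · intro s
    rw [pathLength_restrict]
    exact h.mem _

lemma isAllowed_zero (Ω : DFS) : IsAllowed Ω fun _ => 0 := by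
  refine ⟨⟨0, LipschitzWith.const 0⟩, rfl, fun t => ?_⟩
  have h0 : pathLength (fun _ => 0) t = 0 := by
    unfold pathLength
    rw [eVariationOn.constant_on]
    · rfl
    · rintro _ ⟨_, _, rfl⟩ _ ⟨_, _, rfl⟩; rfl
  rw [h0]
  obtain ⟨δ, hδ, h⟩ := Ω.empty'
  intro hc
  obtain ⟨x, hx, hxS⟩ := mem_closure_iff.1 hc (Prod.fst ⁻¹' Iio δ)
    (isOpen_Iio.preimage continuous_fst) hδ
  have : x.2 ∈ Ω δ := Ω.mono' _ _ (le_of_lt hx) hxS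
  rw [h] at this
  exact this

namespace AllowedPath

variable {Ω : DFS}

open Classical in
/-- The path `γ + t w`, if it is allowed (as it is for small `w`). -/
def bend (γ : AllowedPath Ω) (w : ℂ) : AllowedPath Ω :=
  if h : IsAllowed Ω (shear γ.1 w) then ⟨_, h⟩ else γ

/-- The restriction of an allowed path to `[0, t]`. -/
def restrict (γ : AllowedPath Ω) (t : I) : AllowedPath Ω := ⟨_, isAllowed_restrict γ.2 t⟩

/-- The constant path. -/
def zero (Ω : DFS) : AllowedPath Ω := ⟨_, isAllowed_zero Ω⟩

lemma continuous (γ : AllowedPath Ω) : Continuous γ.1 := γ.2.lipschitz.choose_spec.continuous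

lemma eventually_bend (γ : AllowedPath Ω) : ∀ᶠ w in 𝓝 (0 : ℂ), (γ.bend w).1 = shear γ.1 w := by
  filter_upwards [eventually_isAllowed_shear γ.2] with w hw
  simp [bend, hw]

lemma exists_ball (γ : AllowedPath Ω) {P : ℂ → Prop} (hP : ∀ᶠ w in 𝓝 (0 : ℂ), P w) :
    ∃ ε > 0, ∀ w ∈ Metric.ball (0 : ℂ) ε, (γ.bend w).1 = shear γ.1 w ∧ P w :=
  Metric.eventually_nhds_iff_ball.1 (γ.eventually_bend.and hP)

lemma shear_one (γ : I → ℂ) (w : ℂ) : shear γ w 1 = γ 1 + w := by simp [shear]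

lemma bend_zero (γ : AllowedPath Ω) : γ.bend 0 = γ := by
  have := γ.eventually_bend.self_of_nhds
  exact Subtype.ext (this.trans (shear_zero _))

lemma bend_bend (γ : AllowedPath Ω) {w w' : ℂ} (h : (γ.bend w).1 = shear γ.1 w)
    (h' : ((γ.bend w).bend w').1 = shear (γ.bend w).1 w')
    (h'' : (γ.bend (w + w')).1 = shear γ.1 (w + w')) :
    (γ.bend w).bend w' = γ.bend (w + w') :=
  Subtype.ext (by rw [h', h, h'', shear_shear])

lemma restrict_one (γ : AllowedPath Ω) : γ.restrict 1 = γ :=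
  Subtype.ext (by ext s; simp [restrict, Resurgence.restrict])

lemma restrict_zero (γ : AllowedPath Ω) : γ.restrict 0 = zero Ω :=
  Subtype.ext (by ext s; simp [restrict, Resurgence.restrict, zero, γ.2.zero])

end AllowedPath

/-! ### Surfaces of classes of allowed paths -/

/-- An equivalence relation on `Π_Ω` whose quotient is, in a natural way, an `Ω`-endless Riemann
surface. -/
structure PathRelation (Ω : DFS) where
  rel : Setoid (AllowedPath Ω)
  end_eq : ∀ γ γ', rel γ γ' → γ.1 1 = γ'.1 1
  bend : ∀ γ γ', rel γ γ' → ∀ᶠ w in 𝓝 (0 : ℂ), rel (γ.bend w) (γ'.bend w)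
  separated : ∀ γ γ', γ.1 1 = γ'.1 1 → ¬ rel γ γ' →
    ∀ᶠ w in 𝓝 (0 : ℂ), ¬ rel (γ.bend w) (γ'.bend w)
  restrict : ∀ (γ : AllowedPath Ω) (t : I),
    ∀ᶠ t' in 𝓝 t, rel (γ.restrict t') ((γ.restrict t).bend (γ.1 t' - γ.1 t))

namespace PathRelation

variable {Ω : DFS} (R : PathRelation Ω)

/-- The quotient of `Π_Ω` by the relation. -/
def Space : Type := Quotient R.rel

/-- The class of a path. -/
def pt (γ : AllowedPath Ω) : R.Space := Quotient.mk R.rel γ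

lemma pt_eq {γ γ' : AllowedPath Ω} : R.pt γ = R.pt γ' ↔ R.rel γ γ' := Quotient.eq (r := R.rel)

lemma exists_pt (x : R.Space) : ∃ γ, R.pt γ = x := Quotient.exists_rep x

/-- The projection sends the class of a path to its end point. -/
def proj : R.Space → ℂ := Quotient.lift (fun γ : AllowedPath Ω => γ.1 1) R.end_eq

@[simp] lemma proj_pt (γ : AllowedPath Ω) : R.proj (R.pt γ) = γ.1 1 := rfl

/-- A neighbourhood of the class of `γ` consists of the classes of `γ + t w`, for `w` small. -/
instance : TopologicalSpace R.Space where
  IsOpen U := ∀ γ, R.pt γ ∈ U → ∀ᶠ w in 𝓝 (0 : ℂ), R.pt (γ.bend w) ∈ U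
  isOpen_univ := by simp
  isOpen_inter U V hU hV γ h := (hU γ h.1).and (hV γ h.2)
  isOpen_sUnion s hs γ := by
    rintro ⟨U, hU, h⟩
    filter_upwards [hs U hU γ h] with w hw
    exact ⟨U, hU, hw⟩

lemma isOpen_iff {U : Set R.Space} :
    IsOpen U ↔ ∀ γ, R.pt γ ∈ U → ∀ᶠ w in 𝓝 (0 : ℂ), R.pt (γ.bend w) ∈ U := Iff.rfl

lemma continuous_proj : Continuous R.proj := by
  refine ⟨fun V hV γ hγ => ?_⟩
  have h : ContinuousAt (fun w => γ.1 1 + w) 0 := by fun_prop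
  have h' := h.eventually_mem (by simpa using hV.mem_nhds hγ)
  filter_upwards [h', γ.eventually_bend] with w hw hb
  change (γ.bend w).1 1 ∈ V
  rwa [hb, AllowedPath.shear_one]

/-- The local section of the projection through the class of `γ`. -/
def sec (γ : AllowedPath Ω) (z : ℂ) : R.Space := R.pt (γ.bend (z - γ.1 1))

lemma sec_self (γ : AllowedPath Ω) : R.sec γ (γ.1 1) = R.pt γ := by
  simp [sec, AllowedPath.bend_zero]

/-- A radius on which the local section is defined. -/
def radius (γ : AllowedPath Ω) : ℝ :=
  (Metric.eventually_nhds_iff_ball.1 γ.eventually_bend).choose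

lemma radius_pos (γ : AllowedPath Ω) : 0 < radius γ :=
  (Metric.eventually_nhds_iff_ball.1 γ.eventually_bend).choose_spec.1

lemma bend_of_lt {γ : AllowedPath Ω} {w : ℂ} (h : ‖w‖ < radius γ) :
    (γ.bend w).1 = shear γ.1 w :=
  (Metric.eventually_nhds_iff_ball.1 γ.eventually_bend).choose_spec.2 w
    (by rw [Metric.mem_ball, dist_zero_right]; exact h)

lemma proj_sec {γ : AllowedPath Ω} {z : ℂ} (h : z ∈ Metric.ball (γ.1 1) (radius γ)) :
    R.proj (R.sec γ z) = z := by
  rw [Metric.mem_ball, dist_eq_norm] at h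
  simp [sec, bend_of_lt h, AllowedPath.shear_one]

lemma pt_bend_sec {γ : AllowedPath Ω} {z : ℂ} (h : z ∈ Metric.ball (γ.1 1) (radius γ)) :
    ∀ᶠ w in 𝓝 (0 : ℂ), R.pt ((γ.bend (z - γ.1 1)).bend w) = R.sec γ (z + w) := by
  have h1 : ContinuousAt (fun w => z + w) 0 := by fun_prop
  have h2 := h1.eventually_mem (by simpa using Metric.isOpen_ball.mem_nhds h)
  filter_upwards [(γ.bend (z - γ.1 1)).eventually_bend, h2] with w hb hw
  rw [Metric.mem_ball, dist_eq_norm] at h hw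
  have e : z - γ.1 1 + w = z + w - γ.1 1 := by ring
  rw [sec, AllowedPath.bend_bend γ (bend_of_lt h) hb (by rw [e]; exact bend_of_lt hw), e]

lemma eventually_sec {γ η : AllowedPath Ω} {z : ℂ} (h : z ∈ Metric.ball (γ.1 1) (radius γ))
    (hη : R.pt η = R.sec γ z) : ∀ᶠ w in 𝓝 (0 : ℂ), R.pt (η.bend w) = R.sec γ (z + w) := by
  filter_upwards [R.pt_bend_sec h, R.bend _ _ (R.pt_eq.1 hη)] with w hw hb
  rw [← hw]
  exact R.pt_eq.2 hb

lemma isOpen_sec_image {γ : AllowedPath Ω} {V : Set ℂ} (hV : IsOpen V)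
    (hs : V ⊆ Metric.ball (γ.1 1) (radius γ)) : IsOpen (R.sec γ '' V) := by
  rintro η ⟨z, hz, hη⟩
  have h1 : ContinuousAt (fun w => z + w) 0 := by fun_prop
  have h2 := h1.eventually_mem (by simpa using hV.mem_nhds hz)
  filter_upwards [R.eventually_sec (hs hz) hη.symm, h2] with w hw hw'
  exact ⟨_, hw', hw.symm⟩

lemma continuousOn_sec (γ : AllowedPath Ω) :
    ContinuousOn (R.sec γ) (Metric.ball (γ.1 1) (radius γ)) := by
  rw [continuousOn_open_iff Metric.isOpen_ball]
  intro U hU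
  rw [isOpen_iff_mem_nhds]
  rintro z ⟨hz, hzU⟩
  refine inter_mem (Metric.isOpen_ball.mem_nhds hz) ?_
  have h := (hU (γ.bend (z - γ.1 1)) hzU).and (R.pt_bend_sec hz)
  have h1 : Tendsto (fun y => y - z) (𝓝 z) (𝓝 0) := by
    have : ContinuousAt (fun y => y - z) z := by fun_prop
    simpa [ContinuousAt] using this
  filter_upwards [h1.eventually h] with y hy
  have := hy.2 ▸ hy.1
  simpa using this

/-- The chart at the class of `γ`: a restriction of the projection. -/
def chart (γ : AllowedPath Ω) : OpenPartialHomeomorph R.Space ℂ where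
  toFun := R.proj
  invFun := R.sec γ
  source := R.sec γ '' Metric.ball (γ.1 1) (radius γ)
  target := Metric.ball (γ.1 1) (radius γ)
  map_source' := by
    rintro _ ⟨z, hz, rfl⟩
    rwa [R.proj_sec hz]
  map_target' z hz := mem_image_of_mem _ hz
  left_inv' := by
    rintro _ ⟨z, hz, rfl⟩
    rw [R.proj_sec hz]
  right_inv' z hz := R.proj_sec hz
  open_source := R.isOpen_sec_image Metric.isOpen_ball le_rfl
  open_target := Metric.isOpen_ball
  continuousOn_toFun := R.continuous_proj.continuousOn
  continuousOn_invFun := R.continuousOn_sec γ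

lemma mem_chart_source (γ : AllowedPath Ω) : R.pt γ ∈ (R.chart γ).source :=
  ⟨_, Metric.mem_ball_self (radius_pos γ), R.sec_self γ⟩

instance : ChartedSpace ℂ R.Space where
  atlas := range R.chart
  chartAt x := R.chart (R.exists_pt x).choose
  mem_chart_source x := by
    have := R.mem_chart_source (R.exists_pt x).choose
    rwa [(R.exists_pt x).choose_spec] at this
  chart_mem_atlas x := mem_range_self _

instance : IsManifold 𝓘(ℂ, ℂ) ω R.Space := by
  refine isManifold_of_contDiffOn _ _ _ ?_
  rintro _ _ ⟨γ, rfl⟩ ⟨γ', rfl⟩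
  refine contDiffOn_id.congr ?_
  rintro z ⟨hz, -⟩
  exact (R.chart γ).right_inv hz.1

lemma isLocalDiffeomorph_proj : IsLocalDiffeomorph 𝓘(ℂ, ℂ) 𝓘(ℂ, ℂ) ω R.proj := by
  intro x
  obtain ⟨γ, rfl⟩ := R.exists_pt x
  have hmem : R.chart γ ∈ IsManifold.maximalAtlas 𝓘(ℂ, ℂ) ω R.Space :=
    IsManifold.subset_maximalAtlas (mem_range_self γ)
  exact ⟨{ toPartialEquiv := (R.chart γ).toPartialEquiv
           open_source := (R.chart γ).open_source
           open_target := (R.chart γ).open_target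
           contMDiffOn_toFun := contMDiffOn_of_mem_maximalAtlas hmem
           contMDiffOn_invFun := contMDiffOn_symm_of_mem_maximalAtlas hmem },
    R.mem_chart_source γ, fun _ _ => rfl⟩

instance : T2Space R.Space := by
  refine ⟨fun x y hxy => ?_⟩
  obtain ⟨γ, rfl⟩ := R.exists_pt x
  obtain ⟨γ', rfl⟩ := R.exists_pt y
  by_cases h : γ.1 1 = γ'.1 1
  · obtain ⟨ε, hε, hb⟩ := Metric.eventually_nhds_iff_ball.1
      (R.separated γ γ' h fun hr => hxy (R.pt_eq.2 hr))
    set r := min ε (min (radius γ) (radius γ')) with hr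
    have hr0 : 0 < r := lt_min hε (lt_min (radius_pos _) (radius_pos _))
    have s1 : Metric.ball (γ.1 1) r ⊆ Metric.ball (γ.1 1) (radius γ) :=
      Metric.ball_subset_ball ((min_le_right _ _).trans (min_le_left _ _))
    have s2 : Metric.ball (γ'.1 1) r ⊆ Metric.ball (γ'.1 1) (radius γ') :=
      Metric.ball_subset_ball ((min_le_right _ _).trans (min_le_right _ _))
    refine ⟨R.sec γ '' Metric.ball (γ.1 1) r, R.sec γ' '' Metric.ball (γ'.1 1) r,
      R.isOpen_sec_image Metric.isOpen_ball s1, R.isOpen_sec_image Metric.isOpen_ball s2,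
      ⟨_, Metric.mem_ball_self hr0, R.sec_self γ⟩, ⟨_, Metric.mem_ball_self hr0, R.sec_self γ'⟩, ?_⟩
    rw [Set.disjoint_left]
    rintro _ ⟨z, hz, rfl⟩ ⟨z', hz', he⟩
    have hzz : z' = z := by
      rw [← R.proj_sec (s2 hz'), he, R.proj_sec (s1 hz)]
    subst hzz
    refine hb (z' - γ.1 1) ?_ (R.pt_eq.1 ?_)
    · rw [Metric.mem_ball, dist_eq_norm] at hz
      simpa using hz.trans_le (min_le_left _ _)
    · have := he.symm
      rwa [sec, sec, ← h] at this
  · obtain ⟨U, V, hU, hV, hx, hy, hd⟩ := t2_separation h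
    exact ⟨_, _, hU.preimage R.continuous_proj, hV.preimage R.continuous_proj, hx, hy,
      hd.preimage _⟩

/-- The lift of an allowed path `γ` sends `t` to the class of the restriction of `γ` to `[0, t]`. -/
lemma continuous_pt_restrict (γ : AllowedPath Ω) : Continuous fun t => R.pt (γ.restrict t) := by
  rw [continuous_iff_continuousAt]
  intro t
  have h1 : (γ.restrict t).1 1 = γ.1 t := by
    simp [AllowedPath.restrict, Resurgence.restrict]
  have h2 : ContinuousAt (R.sec (γ.restrict t)) (γ.1 t) := by
    refine (R.continuousOn_sec (γ.restrict t)).continuousAt (Metric.isOpen_ball.mem_nhds ?_)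
    rw [← h1]
    exact Metric.mem_ball_self (radius_pos _)
  refine (h2.comp γ.continuous.continuousAt).congr ?_
  filter_upwards [R.restrict γ t] with t' ht'
  rw [Function.comp, sec, h1]
  exact (R.pt_eq.2 ht').symm

instance : ConnectedSpace R.Space := by
  have : PathConnectedSpace R.Space := by
    rw [pathConnectedSpace_iff_eq]
    refine ⟨R.pt (AllowedPath.zero Ω), eq_univ_of_forall fun x => ?_⟩
    obtain ⟨γ, rfl⟩ := R.exists_pt x
    exact ⟨{ toFun := fun t => R.pt (γ.restrict t)
             continuous_toFun := R.continuous_pt_restrict γ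
             source' := by simp [AllowedPath.restrict_zero]
             target' := by simp [AllowedPath.restrict_one] }⟩
  infer_instance

/-- The quotient of `Π_Ω` as an `Ω`-endless Riemann surface. -/
def surface : EndlessSurface Ω where
  carrier := R.Space
  proj := R.proj
  proj_localBihol := R.isLocalDiffeomorph_proj
  base := R.pt (AllowedPath.zero Ω)
  proj_base := rfl
  exists_lift γ h := ⟨fun t => R.pt (AllowedPath.restrict ⟨γ, h⟩ t), R.continuous_pt_restrict _,
    by simp [AllowedPath.restrict_zero], fun t => by
      simp [AllowedPath.restrict, Resurgence.restrict]⟩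

/-- The lift of an allowed path ends at its class. -/
lemma endpoint_surface (γ : AllowedPath Ω) : R.surface.endpoint γ = R.pt γ := by
  have := R.surface.lift_unique γ (c := fun t => R.pt (γ.restrict t)) (R.continuous_pt_restrict γ)
    (by change R.pt _ = R.pt _; simp [AllowedPath.restrict_zero])
    (fun t => by change (γ.restrict t).1 1 = _; simp [AllowedPath.restrict, Resurgence.restrict])
  rw [EndlessSurface.endpoint, ← this]
  exact congrArg R.pt γ.restrict_one

end PathRelation

/-! ### The initial endless Riemann surface `X_Ω` -/

namespace EndlessSurface

variable {Ω : DFS} (X : EndlessSurface Ω)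

lemma endpoint_restrict (γ : AllowedPath Ω) (t : I) :
    X.endpoint (γ.restrict t) = X.lift γ t := by
  have hc : Continuous fun s : I => X.lift γ (t * s) :=
    (X.continuous_lift γ).comp (continuous_const.mul continuous_id)
  have := X.lift_unique (γ.restrict t) hc (by simp [X.lift_zero]) (fun s => X.proj_lift γ _)
  rw [endpoint, ← this]
  simp

/-- The end points of the lifts of `γ + t w` depend continuously on `w`. -/
lemma continuousOn_endpoint_bend (γ : AllowedPath Ω) {r : ℝ}
    (hr : ∀ w ∈ Metric.ball (0 : ℂ) r, (γ.bend w).1 = shear γ.1 w) :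
    ContinuousOn (fun w => X.endpoint (γ.bend w)) (Metric.ball (0 : ℂ) r) := by
  rw [continuousOn_iff_continuous_domRestrict]
  let f : C(I × Metric.ball (0 : ℂ) r, ℂ) :=
    ⟨fun x => shear γ.1 x.2 x.1, by
      have := γ.continuous
      unfold shear
      fun_prop⟩
  have := X.isLocalHomeomorph_proj.continuous_lift X.isSeparatedMap_proj f
    (g := fun x => X.lift (γ.bend x.2) x.1) ?_ ?_ ?_
  · exact this.comp (Continuous.prodMk_right 1)
  · ext ⟨t, w⟩
    simp only [Function.comp, X.proj_lift, hr w.1 w.2]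
    rfl
  · simp only [X.lift_zero]
    exact continuous_const
  · exact fun w => X.continuous_lift (γ.bend w.1)

lemma proj_endpoint (γ : AllowedPath Ω) : X.proj (X.endpoint γ) = γ.1 1 := X.proj_lift γ 1

lemma exists_continuousOn_endpoint (γ : AllowedPath Ω) :
    ∃ r > 0, ContinuousOn (fun w => X.endpoint (γ.bend w)) (Metric.ball (0 : ℂ) r) ∧
      ∀ w ∈ Metric.ball (0 : ℂ) r, (γ.bend w).1 = shear γ.1 w := by
  obtain ⟨r, hr, h⟩ := Metric.eventually_nhds_iff_ball.1 γ.eventually_bend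
  exact ⟨r, hr, X.continuousOn_endpoint_bend γ h, h⟩

end EndlessSurface

/-- Two allowed paths are equivalent if they have the same end point and if their lifts have the
same end point in every `Ω`-endless Riemann surface. -/
def initialSetoid (Ω : DFS) : Setoid (AllowedPath Ω) where
  r γ γ' := γ.1 1 = γ'.1 1 ∧ ∀ X : EndlessSurface Ω, X.endpoint γ = X.endpoint γ'
  iseqv := ⟨fun _ => ⟨rfl, fun _ => rfl⟩, fun h => ⟨h.1.symm, fun X => (h.2 X).symm⟩,
    fun h h' => ⟨h.1.trans h'.1, fun X => (h.2 X).trans (h'.2 X)⟩⟩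

/-- The relation that defines `X_Ω`. -/
def initialRelation (Ω : DFS) : PathRelation Ω where
  rel := initialSetoid Ω
  end_eq _ _ h := h.1
  bend γ γ' h := by
    obtain ⟨r, hr, hb⟩ := Metric.eventually_nhds_iff_ball.1
      (γ.eventually_bend.and γ'.eventually_bend)
    filter_upwards [Metric.ball_mem_nhds (0 : ℂ) hr] with w hw
    refine ⟨?_, fun X => ?_⟩
    · rw [(hb w hw).1, (hb w hw).2, AllowedPath.shear_one, AllowedPath.shear_one, h.1]
    · refine X.isSeparatedMap_proj.eqOn_of_comp_eqOn
        X.isLocalHomeomorph_proj.isLocallyInjective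
        (convex_ball (0 : ℂ) r).isPreconnected
        (X.continuousOn_endpoint_bend γ fun w hw => (hb w hw).1)
        (X.continuousOn_endpoint_bend γ' fun w hw => (hb w hw).2) ?_
        (Metric.mem_ball_self hr) ?_ hw
      · intro w hw
        simp only [Function.comp, X.proj_endpoint, (hb w hw).1, (hb w hw).2,
          AllowedPath.shear_one, h.1]
      · simpa [AllowedPath.bend_zero] using h.2 X
  separated γ γ' h hn := by
    have : ∃ X : EndlessSurface Ω, X.endpoint γ ≠ X.endpoint γ' := by
      by_contra! hc
      exact hn ⟨h, hc⟩
    obtain ⟨X, hX⟩ := this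
    obtain ⟨r, hr, hc, -⟩ := X.exists_continuousOn_endpoint γ
    obtain ⟨r', hr', hc', -⟩ := X.exists_continuousOn_endpoint γ'
    have h1 := hc.continuousAt (Metric.ball_mem_nhds _ hr)
    have h2 := hc'.continuousAt (Metric.ball_mem_nhds _ hr')
    have h3 := h1.ne_iff_eventually_ne h2 |>.1 (by simpa [AllowedPath.bend_zero] using hX)
    filter_upwards [h3] with w hw hw'
    exact hw (hw'.2 X)
  restrict γ t := by
    have ht1 : (γ.restrict t).1 1 = γ.1 t := by
      simp [AllowedPath.restrict, Resurgence.restrict]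
    obtain ⟨r, hr, hb⟩ := Metric.eventually_nhds_iff_ball.1 (γ.restrict t).eventually_bend
    obtain ⟨δ, hδ, hcont⟩ := Metric.continuousAt_iff.1 (γ.continuous.continuousAt (x := t)) r hr
    have hpre : IsPreconnected (Metric.ball t δ) := by
      have : OrdConnected (Metric.ball t δ) := by
        refine ⟨fun x hx y hy z hz => ?_⟩
        simp only [Metric.mem_ball, Subtype.dist_eq, Real.dist_eq, abs_lt] at *
        have h1 : (x : ℝ) ≤ z := hz.1
        have h2 : (z : ℝ) ≤ y := hz.2
        constructor <;> linarith
      exact this.isPreconnected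
    have hmem : ∀ t' ∈ Metric.ball t δ, γ.1 t' - γ.1 t ∈ Metric.ball (0 : ℂ) r := fun t' ht' => by
      simpa [dist_eq_norm] using hcont ht'
    filter_upwards [Metric.ball_mem_nhds t hδ] with t' ht'
    refine ⟨?_, fun X => ?_⟩
    · rw [hb _ (hmem t' ht'), AllowedPath.shear_one, ht1]
      simp [AllowedPath.restrict, Resurgence.restrict]
    · rw [X.endpoint_restrict]
      refine X.isSeparatedMap_proj.eqOn_of_comp_eqOn
        X.isLocalHomeomorph_proj.isLocallyInjective hpre (X.continuous_lift γ).continuousOn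
        (g₂ := fun t' => X.endpoint ((γ.restrict t).bend (γ.1 t' - γ.1 t)))
        ((X.continuousOn_endpoint_bend (γ.restrict t) hb).comp
          (γ.continuous.sub continuous_const).continuousOn hmem) ?_
        (Metric.mem_ball_self hδ) ?_ ht'
      · intro s hs
        simp only [Function.comp, X.proj_endpoint, hb _ (hmem s hs), AllowedPath.shear_one, ht1,
          X.proj_lift]
        ring
      · simp [AllowedPath.bend_zero, X.endpoint_restrict]

/-- The `Ω`-endless Riemann surface `X_Ω`. Its points are the classes of allowed paths, two paths
being identified when their lifts have the same end point in every `Ω`-endless Riemann surface. -/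
def XOmega (Ω : DFS) : EndlessSurface Ω := (initialRelation Ω).surface

/-- `X_Ω` is the initial object of the category of `Ω`-endless Riemann surfaces. -/
theorem XOmega_initial {Ω : DFS} (Y : EndlessSurface Ω) :
    ∃! q : XOmega Ω → Y, EndlessSurface.IsMorphism (XOmega Ω) Y q := by
  let q : XOmega Ω → Y := Quotient.lift (s := initialSetoid Ω) Y.endpoint fun _ _ h => h.2 Y
  have hproj : ∀ x, Y.proj (q x) = (XOmega Ω).proj x := by
    intro x
    obtain ⟨γ, rfl⟩ := (initialRelation Ω).exists_pt x
    exact Y.proj_endpoint γ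
  have hcont : Continuous q := by
    refine ⟨fun U hU γ hγ => ?_⟩
    obtain ⟨r, hr, hc, -⟩ := Y.exists_continuousOn_endpoint γ
    have h1 := hc.continuousAt (Metric.ball_mem_nhds _ hr)
    refine h1.eventually_mem (hU.mem_nhds ?_)
    rw [AllowedPath.bend_zero]
    exact hγ
  have hbase : q (XOmega Ω).base = Y.base := by
    change Y.endpoint (AllowedPath.zero Ω) = _
    rw [← AllowedPath.restrict_zero (AllowedPath.zero Ω), Y.endpoint_restrict, Y.lift_zero]
  refine ⟨q, ⟨fun x => ?_, hproj, hbase⟩, fun q' hq' => ?_⟩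
  · obtain ⟨Φ, hx, hΦ⟩ := (XOmega Ω).proj_localBihol x
    obtain ⟨Ψ, hy, hΨ⟩ := Y.proj_localBihol (q x)
    let e := (Φ.toOpenPartialHomeomorph.trans Ψ.toOpenPartialHomeomorph.symm).restrOpen
      (q ⁻¹' Ψ.source) (Ψ.open_source.preimage hcont)
    have hs : ∀ y ∈ e.source, y ∈ Φ.source ∧ Φ y ∈ Ψ.target ∧ q y ∈ Ψ.source :=
      fun y hy => ⟨hy.1.1, hy.1.2, hy.2⟩
    have he : ∀ y ∈ e.source, e y = q y := fun y hy => by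
      obtain ⟨h1, h2, h3⟩ := hs y hy
      change Ψ.invFun (Φ y) = q y
      rw [← hΦ h1, ← hproj, hΨ h3]
      exact Ψ.left_inv h3
    refine ⟨{ toPartialEquiv := e.toPartialEquiv
              open_source := e.open_source
              open_target := e.open_target
              contMDiffOn_toFun := ?_
              contMDiffOn_invFun := ?_ }, ?_, fun y hy => (he y hy).symm⟩
    · exact Ψ.contMDiffOn_invFun.comp (Φ.contMDiffOn_toFun.mono fun y hy => (hs y hy).1)
        fun y hy => (hs y hy).2.1
    · refine Φ.contMDiffOn_invFun.comp (Ψ.contMDiffOn_toFun.mono fun z hz => ?_) fun z hz => ?_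
      · have := e.map_target hz
        rw [← e.right_inv hz, he _ this]
        exact (hs _ this).2.2
      · exact hz.1.2
    · refine ⟨⟨hx, ?_⟩, hy⟩
      change Φ x ∈ Ψ.target
      rw [← hΦ hx, ← hproj, hΨ hy]
      exact Ψ.map_source hy
  · refine Y.isSeparatedMap_proj.eq_of_comp_eq Y.isLocalHomeomorph_proj.isLocallyInjective
      hq'.localBihol.contMDiff.continuous hcont ?_ (XOmega Ω).base (by rw [hq'.base, hbase])
    ext x
    simp [hproj, hq'.proj]

/-! ### Continuable functions -/

/-- The germ at `0` of `φ` can be analytically continued along the path `γ` (with `γ(0) = 0`):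
there are germs `f t` at `γ(t)` that depend on `t` in a locally consistent way. -/
def HasContinuationAlong (φ : ℂ → ℂ) (γ : I → ℂ) : Prop :=
  ∃ f : I → ℂ → ℂ, (∀ t, AnalyticAt ℂ (f t) (γ t)) ∧ f 0 =ᶠ[𝓝 0] φ ∧
    ∀ t, ∀ᶠ t' in 𝓝 t, f t' =ᶠ[𝓝 (γ t')] f t

/-- `Ω`-continuable germs. A germ in `ℂ{ξ}` is given by a representative `φ : ℂ → ℂ`; only its
values near `0` matter. -/
structure IsContinuable (Ω : DFS) (φ : ℂ → ℂ) : Prop where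
  analyticAt : AnalyticAt ℂ φ 0
  continuation : ∀ γ : I → ℂ, IsAllowed Ω γ → HasContinuationAlong φ γ

/-- `F` is a holomorphic function on `X_Ω` that coincides near the base point with the pull-back of
the germ `φ` by the projection. As `X_Ω` is connected, there is at most one such `F`. -/
structure IsHolomorphicPullback (Ω : DFS) (φ : ℂ → ℂ) (F : XOmega Ω → ℂ) : Prop where
  holomorphic : MDifferentiable 𝓘(ℂ, ℂ) 𝓘(ℂ, ℂ) F
  germ : F =ᶠ[𝓝 (XOmega Ω).base] φ ∘ (XOmega Ω).proj

open Classical in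
/-- The function `𝔭_Ω^* φ` on `X_Ω` (with value `0` if the germ `φ` is not `Ω`-continuable). -/
def pullbackGerm (Ω : DFS) (φ : ℂ → ℂ) : XOmega Ω → ℂ :=
  if h : ∃ F, IsHolomorphicPullback Ω φ F then h.choose else 0

/-- The path `γ_ξ : t ↦ t ξ`. -/
def ray (ξ : ℂ) : I → ℂ := fun t => (t : ℝ) • ξ

open Classical in
/-- The map `ξ ↦ γ̲_ξ(1)`, where `γ̲_ξ` is the lift of `γ_ξ` to `X_Ω`; it is defined
(in particular) for `|ξ| < ρ(Ω)`, and has the base point as a default value. -/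
def rayLift (Ω : DFS) (ξ : ℂ) : XOmega Ω :=
  if h : IsAllowed Ω (ray ξ) then (XOmega Ω).lift ⟨_, h⟩ 1 else (XOmega Ω).base

/-! ### Convolution -/

/-- The convolution product `∫_0^ξ f(ξ - ξ') g(ξ') dξ'` (along the segment `ξ' = t ξ`). -/
def conv (f g : ℂ → ℂ) (ξ : ℂ) : ℂ :=
  ∫ t in (0 : ℝ)..1, f (ξ - t • ξ) * g (t • ξ) * ξ

/-- The product on `ℂ δ ⊕ ℂ{ξ}`: the pair `(a, f)` stands for `a δ + f`. -/
def convMul (x y : ℂ × (ℂ → ℂ)) : ℂ × (ℂ → ℂ) :=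
  (x.1 * y.1, fun ξ => x.1 * y.2 ξ + y.1 * x.2 ξ + conv x.2 y.2 ξ)

/-- The unit `δ` of `ℂ δ ⊕ ℂ{ξ}`. -/
def delta : ℂ × (ℂ → ℂ) := (1, fun _ => 0)

/-- The convolution product of a list of germs, as an element of `ℂ δ ⊕ ℂ{ξ}`; it is `δ` for the
empty list. As a germ at `0`, it does not depend on the order of the list. -/
def convProd (l : List (ℂ → ℂ)) : ℂ × (ℂ → ℂ) :=
  l.foldr (fun g x => convMul (0, g) x) delta

/-! ### Iteration diagrams -/

/-- An iteration diagram with set of vertices `V`: a directed tree (an orientation of a tree) in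
which every vertex has at most one outgoing edge. -/
structure IterationDiagram (V : Type*) extends Digraph V where
  isTree : toDigraph.toSimpleGraphInclusive.IsTree
  asymm : ∀ u v, Adj u v → ¬ Adj v u
  out_unique : ∀ u v v', Adj u v → Adj u v' → v = v'

namespace IterationDiagram

variable {V : Type*} [Fintype V] (T : IterationDiagram V)

/-- There is a (directed) path `u → ⋯ → v`. -/
def Reaches (u v : V) : Prop := Relation.ReflTransGen T.Adj u v

/-- `v` is a leaf: it has no incoming edge. -/
def IsLeaf (v : V) : Prop := ∀ u, ¬ T.Adj u v

lemma exists_sink : ∃ r, ∀ v, ¬ T.Adj r v := by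
  classical
  by_contra! h
  choose o ho using h
  have hmem : ∀ v, s(v, o v) ∈ T.toDigraph.toSimpleGraphInclusive.edgeFinset := fun v => by
    rw [SimpleGraph.mem_edgeFinset, SimpleGraph.mem_edgeSet]
    refine ⟨fun e => ?_, Or.inl (ho v)⟩
    have := ho v
    rw [← e] at this
    exact T.asymm _ _ this this
  have hinj : Function.Injective fun v => s(v, o v) := by
    intro u v huv
    rcases Sym2.eq_iff.1 huv with ⟨h, -⟩ | ⟨h1, h2⟩
    · exact h
    · have hu := ho u
      have hv := ho v
      rw [h2] at hu
      rw [← h1] at hv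
      exact absurd hu (T.asymm _ _ hv)
  have hcard := Finset.card_le_card_of_injOn (s := Finset.univ) _ (fun v _ => hmem v)
    hinj.injOn
  have := T.isTree.card_edgeFinset
  rw [Finset.card_univ] at hcard
  omega

/-- There is a unique vertex that can be reached from every vertex. -/
lemma existsUnique_root : ∃! r, ∀ v, T.Reaches v r := by
  obtain ⟨r, hr⟩ := T.exists_sink
  have hreach : ∀ v, T.Reaches v r := by
    intro v
    have h := T.isTree.connected.preconnected r v
    rw [SimpleGraph.reachable_iff_reflTransGen] at h
    induction h with
    | refl => exact Relation.ReflTransGen.refl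
    | @tail b c _ hbc ih =>
      rcases hbc.2 with h1 | h1
      · rcases Relation.ReflTransGen.cases_head ih with rfl | ⟨d, hd, hdr⟩
        · exact absurd h1 (hr c)
        · rw [T.out_unique _ _ _ h1 hd]
          exact hdr
      · exact Relation.ReflTransGen.head h1 ih
  refine ⟨r, hreach, fun r' hr' => ?_⟩
  rcases Relation.ReflTransGen.cases_head (hr' r) with h | ⟨d, hd, -⟩
  · exact h.symm
  · exact absurd hd (hr d)

/-- The root of an iteration diagram. -/
def root : V := T.existsUnique_root.choose

lemma reaches_root (v : V) : T.Reaches v T.root := T.existsUnique_root.choose_spec.1 v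

lemma not_adj_root (v : V) : ¬ T.Adj T.root v := by
  obtain ⟨r, hr⟩ := T.exists_sink
  rcases Relation.ReflTransGen.cases_head (T.reaches_root r) with h | ⟨d, hd, -⟩
  · rw [← h]
    exact hr v
  · exact absurd hd (hr d)

lemma wellFounded_adj : WellFounded T.Adj := by
  have h1 : WellFounded fun u v => T.Adj v u := by
    refine ⟨fun v => ?_⟩
    induction T.reaches_root v using Relation.ReflTransGen.head_induction_on with
    | refl => exact ⟨_, fun u hu => absurd hu (T.not_adj_root u)⟩
    | head h _ ih => exact ⟨_, fun u hu => T.out_unique _ _ _ h hu ▸ ih⟩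
  have h2 : ∀ v, ¬ Relation.TransGen T.Adj v v := fun v hv =>
    (h1.transGen).irrefl.irrefl v (Relation.transGen_swap.2 hv)
  have : Std.Irrefl (Relation.TransGen T.Adj) := ⟨h2⟩
  exact Subrelation.wf Relation.TransGen.single
    (Finite.wellFounded_of_trans_of_irrefl (Relation.TransGen T.Adj))

open Classical in
/-- The set `V_v^1` of the vertices `u` that have an edge `u → v`. -/
def children (v : V) : Finset V := {u | T.Adj u v}

lemma mem_children {u v : V} : u ∈ T.children v ↔ T.Adj u v := by simp [children]

/-- The weight of a vertex: the number of leaves from which it can be reached. -/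
def weight (v : V) : ℕ := {l | T.IsLeaf l ∧ T.Reaches l v}.ncard

/-- The family `ψ_v = φ_v · (f_v * ∏^* ψ_u)`, the convolution product being over `u ∈ V_v^1`. -/
def psi (f φ : V → ℂ → ℂ) : V → ℂ → ℂ :=
  T.wellFounded_adj.fix fun v ih ξ => φ v ξ * (convMul (0, f v) (convProd
    ((T.children v).toList.attach.map fun u =>
      ih u.1 (T.mem_children.1 (Finset.mem_toList.1 u.2))))).2 ξ

lemma psi_eq (f φ : V → ℂ → ℂ) (v : V) : T.psi f φ v = fun ξ =>
    φ v ξ * (convMul (0, f v) (convProd ((T.children v).toList.map (T.psi f φ)))).2 ξ := by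
  rw [psi, WellFounded.fix_eq]
  ext ξ
  exact congrArg (fun l => φ v ξ * (convMul (0, f v) (convProd l)).2 ξ)
    (List.attach_map_val (l := (T.children v).toList) (f := T.psi f φ))

/-- The iterated convolution of `(T; (f_v), (φ_v))`. -/
def iteratedConv (f φ : V → ℂ → ℂ) : ℂ → ℂ := T.psi f φ T.root

/-- The set `Δ_T ⊆ ℝ^V`. -/
def simplex : Set (V → ℝ) :=
  {s | (∀ v, 0 ≤ s v) ∧ (∀ v, ∑ u ∈ T.children v, s u ≤ s v) ∧ s T.root = 1}

/-- The set `V° = V \ {root}`. -/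
abbrev NonRoot : Type _ := {v : V // v ≠ T.root}

instance : Fintype T.NonRoot := Fintype.ofFinite _

end IterationDiagram

/-! ### Differential forms and currents -/

section Forms

variable {𝕜 : Type*} [NontriviallyNormedField 𝕜] [NormedSpace 𝕜 ℂ]
  {E : Type*} [NormedAddCommGroup E] [NormedSpace 𝕜 E] {H : Type*} [TopologicalSpace H]
  {E' : Type*} [NormedAddCommGroup E'] [NormedSpace 𝕜 E'] {H' : Type*} [TopologicalSpace H']

/-- Complex valued differential `n`-forms on a manifold, `𝕜`-multilinear at each point. No
regularity is imposed. -/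
def DForm (J : ModelWithCorners 𝕜 E H) (M : Type*) [TopologicalSpace M] [ChartedSpace H M]
    (n : ℕ) : Type _ :=
  ∀ x : M, TangentSpace J x [⋀^Fin n]→L[𝕜] ℂ

/-- The pull-back of a differential form by a map. -/
def DForm.pullback {J : ModelWithCorners 𝕜 E H} {M : Type*} [TopologicalSpace M]
    [ChartedSpace H M] {J' : ModelWithCorners 𝕜 E' H'} {M' : Type*} [TopologicalSpace M']
    [ChartedSpace H' M'] {n : ℕ} (F : M → M') (α : DForm J' M' n) : DForm J M n :=
  fun x => (α (F x)).compContinuousLinearMap (mfderiv J J' F x)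

/-- A form on a complex manifold is holomorphic if its expressions in the charts are. -/
def IsHolomorphicForm {E : Type*} [NormedAddCommGroup E] [NormedSpace ℂ E] {H : Type*}
    [TopologicalSpace H] {J : ModelWithCorners ℂ E H} {M : Type*} [TopologicalSpace M]
    [ChartedSpace H M] {n : ℕ} (α : DForm J M n) : Prop :=
  ∀ x₀ : M, DifferentiableOn ℂ (E := E) (F := E [⋀^Fin n]→L[ℂ] ℂ)
    (DForm.pullback (J := 𝓘(ℂ, E)) (extChartAt J x₀).symm α) (extChartAt J x₀).target

/-- Functionals on the `n`-forms of a real manifold, the home of the `n`-dimensional currents. (The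
values that matter are those at the forms that are smooth near the support of the current.) -/
abbrev FormFunctional {E : Type*} [NormedAddCommGroup E] [NormedSpace ℝ E] {H : Type*}
    [TopologicalSpace H] (J : ModelWithCorners ℝ E H) (M : Type*) [TopologicalSpace M]
    [ChartedSpace H M] (n : ℕ) : Type _ :=
  DForm J M n → ℂ

/-- The push-forward `F_# C` of a current: `(F_# C)(α) = C(F^* α)`. -/
def pushforward {E E' : Type*} [NormedAddCommGroup E] [NormedSpace ℝ E] [NormedAddCommGroup E']
    [NormedSpace ℝ E'] {H H' : Type*} [TopologicalSpace H] [TopologicalSpace H']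
    {J : ModelWithCorners ℝ E H} {M : Type*} [TopologicalSpace M] [ChartedSpace H M]
    {J' : ModelWithCorners ℝ E' H'} {M' : Type*} [TopologicalSpace M'] [ChartedSpace H' M'] {n : ℕ}
    (F : M → M') (C : FormFunctional J M n) : FormFunctional J' M' n :=
  fun α => C (α.pullback F)

end Forms

namespace IterationDiagram

variable {V : Type*} [Fintype V] (T : IterationDiagram V)

open Classical in
/-- The point of `ℝ^V` with coordinate `1` at the root and the given coordinates elsewhere. -/
def withRoot (s : T.NonRoot → ℝ) : V → ℝ := fun v => if h : v ≠ T.root then s ⟨v, h⟩ else 1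

/-- The coordinates `(s_v)_{v ∈ V°}` of the points of `Δ_T`. -/
def simplexCoords : Set (T.NonRoot → ℝ) := T.withRoot ⁻¹' T.simplex

open Classical in
/-- The coefficient of `ds_{e 0} ∧ ⋯ ∧ ds_{e (n-1)}` in the restriction of the form `α` to the
hyperplane `s_root = 1`, in the coordinates `(s_v)_{v ∈ V°}`. -/
def coefficient {n : ℕ} (e : Fin n ≃ T.NonRoot) (α : DForm 𝓘(ℝ, V → ℝ) (V → ℝ) n)
    (s : T.NonRoot → ℝ) : ℂ :=
  α (T.withRoot s) fun i => (Pi.single (e i : V) (1 : ℝ) : V → ℝ)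

/-- The integration current `[Δ_T]`, `α ↦ ∫_{Δ_T} α`. The orientation is the one for which the
integral of `ds_{e 0} ∧ ⋯ ∧ ds_{e (n-1)}` is positive (the volume of `Δ_T`). -/
def integrationCurrent {n : ℕ} (e : Fin n ≃ T.NonRoot) :
    FormFunctional 𝓘(ℝ, V → ℝ) (V → ℝ) n :=
  fun α => ∫ s in T.simplexCoords, T.coefficient e α s

variable (Ω : DFS)

/-- `Ω_v`, the `w_v`-fold sum of `Ω`. -/
def omegaAt (v : V) : DFS := Ω.nsum (T.weight v)

/-- The product `X_Ω^T` of the surfaces `X_{Ω_v}`. -/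
abbrev ProductSurface : Type _ := ∀ v : V, XOmega (T.omegaAt Ω v)

/-- The map `(𝔭_{Ω_v})_v : X_Ω^T → ℂ^V`. -/
def productProj (x : T.ProductSurface Ω) : V → ℂ := fun v => (XOmega (T.omegaAt Ω v)).proj (x v)

/-- The model of a `V`-indexed product of Riemann surfaces, as a complex (`𝕜 = ℂ`) or as a real
(`𝕜 = ℝ`) manifold. -/
abbrev productModel (𝕜 V : Type*) [Fintype V] [NontriviallyNormedField 𝕜] [NormedSpace 𝕜 ℂ] :
    ModelWithCorners 𝕜 (V → ℂ) (ModelPi fun _ : V => ℂ) :=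
  ModelWithCorners.pi fun _ : V => 𝓘(𝕜, ℂ)

/-- The projection of `ℂ^V` to `ℂ^n` given by the coordinates `ξ_{e 0}, …, ξ_{e (n-1)}`. -/
def coordMap {n : ℕ} (e : Fin n ≃ T.NonRoot) : (V → ℂ) →ₗ[ℂ] (Fin n → ℂ) :=
  LinearMap.pi fun i => LinearMap.proj (e i : V)

/-- The form `dξ_{e 0} ∧ ⋯ ∧ dξ_{e (n-1)}` on `ℂ^V`, where `e` enumerates `V°`: its value at
`(w_0, …, w_{n-1})` is the determinant of the matrix `(dξ_{e i}(w_j))`. -/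
def coordForm {n : ℕ} (e : Fin n ≃ T.NonRoot) : DForm 𝓘(ℂ, V → ℂ) (V → ℂ) n := fun _ =>
  let a : (V → ℂ) [⋀^Fin n]→ₗ[ℂ] ℂ := Matrix.detRowAlternating.compLinearMap (T.coordMap e)
  let b : (V → ℂ) [⋀^Fin n]→L[ℂ] ℂ :=
    { toMultilinearMap := a.toMultilinearMap
      cont := by
        change Continuous fun w : Fin n → V → ℂ =>
          Matrix.det (Matrix.of fun j i : Fin n => w j (e i))
        fun_prop
      map_eq_zero_of_eq' := a.map_eq_zero_of_eq' }
  b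

/-- The form `β_T` on `X_Ω^T`. -/
def betaForm {n : ℕ} (e : Fin n ≃ T.NonRoot) (f φ : V → ℂ → ℂ) :
    DForm (productModel ℂ V) (T.ProductSurface Ω) n :=
  fun x => (∏ v, pullbackGerm (T.omegaAt Ω v) (φ v) (x v) *
      f v (T.productProj Ω x v - ∑ u ∈ T.children v, T.productProj Ω x u)) •
    DForm.pullback (T.productProj Ω) (T.coordForm e) x

/-- A complex form on `X_Ω^T`, seen as a form on the underlying real manifold. -/
def toRealForm {n : ℕ} (α : DForm (productModel ℂ V) (T.ProductSurface Ω) n) :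
    DForm (productModel ℝ V) (T.ProductSurface Ω) n := fun x =>
  let a : (V → ℂ) [⋀^Fin n]→L[ℂ] ℂ := α x
  a.restrictScalars ℝ

/-- The map `𝒟(ξ) : s ↦ (ℒ_v(s_v ξ))_v`. -/
def D (ξ : ℂ) (s : V → ℝ) : T.ProductSurface Ω := fun v => rayLift (T.omegaAt Ω v) (s v • ξ)

end IterationDiagram

end Resurgence

end

noncomputable section

namespace Resurgence

/-! ### Analytic continuation along paths -/

/-! Pull-backs. Identifying allowed paths that lead to the same germ of φ yields an Ω-endless
surface (`germRelation`). Two paths with the same class in X_Ω have lifts with the same end point in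
every endless surface, hence in this one, so the value of the continued germ at the end point
descends to X_Ω (`endGerm_congr`). The charts of X_Ω and of its products are restrictions of the
projections; in a chart β_T is therefore a constant form times a holomorphic coefficient.

Reduction to the disc. Sums of Ω with itself create no points below ρ(Ω), so 𝔭^*φ_v composed with
the lifts of rays is a holomorphic function P_v on D_{ρ(Ω)} with germ φ_v at 0. The iterated
convolution formed with the P_v is the extension of ψ_T. Over ℂ^V the map 𝒟(ξ) is s ↦ (s_v ξ)_v, so
the coefficient of 𝒟(ξ)^*β_T is ∏ P_v(s_v ξ) f_v((s_v - ∑ s_u) ξ) times ξ^(k-1)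
(`coefficient_pullback_D`).

Fubini. All functions are restricted to the segment from 0 to ξ and extended by 0 to the line
(`CausalFun`). The inequalities that define Δ_T become support conditions and the integral runs over
all of ℝ^{V°}, so no domain of integration has to be tracked. The variable s_u occurs in the factor
of u, in that of the unique p with u → p, and in those of the children of u. Once the children have
been integrated out, the factor of u is ψ_u on the segment, and integrating over s_u convolves it
into the factor of p. Working from the leaves to the root leaves ψ_T(ξ)
(`integral_partialIntegrand`); each vertex uses up one factor ξ, from dξ' = ξ ds. -/

/-- `f` is an analytic continuation of the germ of `φ` at `0` along the path `γ`. -/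
structure IsContinuation (φ : ℂ → ℂ) (γ : I → ℂ) (f : I → ℂ → ℂ) : Prop where
  analyticAt : ∀ t, AnalyticAt ℂ (f t) (γ t)
  zero : f 0 =ᶠ[𝓝 0] φ
  locallyConst : ∀ t, ∀ᶠ t' in 𝓝 t, f t' =ᶠ[𝓝 (γ t')] f t

lemma exists_ball_analyticOnNhd {g : ℂ → ℂ} {z : ℂ} (h : AnalyticAt ℂ g z) :
    ∃ r > 0, AnalyticOnNhd ℂ g (Metric.ball z r) := by
  obtain ⟨r, hr, hb⟩ := Metric.eventually_nhds_iff_ball.1 h.eventually_analyticAt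
  exact ⟨r, hr, hb⟩

lemma eqOn_ball_of_eventuallyEq {g h : ℂ → ℂ} {z y : ℂ} {r : ℝ}
    (hg : AnalyticOnNhd ℂ g (Metric.ball z r)) (hh : AnalyticOnNhd ℂ h (Metric.ball z r))
    (hy : y ∈ Metric.ball z r) (he : g =ᶠ[𝓝 y] h) : EqOn g h (Metric.ball z r) :=
  hg.eqOn_of_preconnected_of_eventuallyEq hh (convex_ball z r).isPreconnected hy he

namespace IsContinuation

variable {φ : ℂ → ℂ} {γ : I → ℂ} {f f' : I → ℂ → ℂ}

/-- The continuation of a germ along a continuous path that starts at `0` is unique. -/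
lemma unique (hγ : Continuous γ) (h0 : γ 0 = 0) (h : IsContinuation φ γ f)
    (h' : IsContinuation φ γ f') (t : I) : f t =ᶠ[𝓝 (γ t)] f' t := by
  have hopen : IsOpen {t | f t =ᶠ[𝓝 (γ t)] f' t} := by
    rw [isOpen_iff_eventually]
    intro t ht
    filter_upwards [h.locallyConst t, h'.locallyConst t,
      hγ.continuousAt.eventually ht.eventuallyEq_nhds] with s h1 h2 h3
    exact h1.trans (h3.trans h2.symm)
  have hclosed : IsClosed {t | f t =ᶠ[𝓝 (γ t)] f' t} := by
    refine isClosed_of_closure_subset fun t ht => ?_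
    obtain ⟨r, hr, hb⟩ := exists_ball_analyticOnNhd (h.analyticAt t)
    obtain ⟨r', hr', hb'⟩ := exists_ball_analyticOnNhd (h'.analyticAt t)
    have hmin : 0 < min r r' := lt_min hr hr'
    obtain ⟨s, ⟨⟨h1, h2⟩, h3⟩, hs⟩ := mem_closure_iff_nhds.1 ht _
      (inter_mem (inter_mem (h.locallyConst t) (h'.locallyConst t))
        (hγ.continuousAt.preimage_mem_nhds (Metric.ball_mem_nhds (γ t) hmin)))
    -- Near a limit point t of the agreement set there is an s in that set with γ s in a disc on
    -- which both germs at t are analytic; the identity theorem carries the agreement back to γ t.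
    have := eqOn_ball_of_eventuallyEq
      (hb.mono (Metric.ball_subset_ball (min_le_left r r')))
      (hb'.mono (Metric.ball_subset_ball (min_le_right r r'))) h3
      (EventuallyEq.trans (EventuallyEq.symm h1) (EventuallyEq.trans hs h2))
    exact this.eventuallyEq_of_mem (Metric.ball_mem_nhds _ hmin)
  have huniv : {t | f t =ᶠ[𝓝 (γ t)] f' t} = univ :=
    IsClopen.eq_univ ⟨hclosed, hopen⟩ ⟨0, by
      simp only [mem_ofPred_eq, h0]
      exact h.zero.trans h'.zero.symm⟩
  exact huniv.ge (mem_univ t)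

/-- A continuation can be normalized so that its germs converge in discs of a fixed radius. -/
lemma exists_uniform (hγ : Continuous γ) (h : IsContinuation φ γ f) :
    ∃ r > 0, ∃ g : I → ℂ → ℂ, (∀ t, g t =ᶠ[𝓝 (γ t)] f t) ∧
      (∀ t, AnalyticOnNhd ℂ (g t) (Metric.ball (γ t) r)) ∧
      ∀ t, ∀ᶠ t' in 𝓝 t, EqOn (g t') (g t) (Metric.ball (γ t') r) := by
  have hloc : ∀ t, ∃ r > 0, ∃ U : Set I, IsOpen U ∧ t ∈ U ∧ ∀ s ∈ U,
      f s =ᶠ[𝓝 (γ s)] f t ∧ AnalyticOnNhd ℂ (f t) (Metric.ball (γ s) r) := by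
    intro t
    obtain ⟨r, hr, hb⟩ := exists_ball_analyticOnNhd (h.analyticAt t)
    have h1 := hγ.continuousAt.preimage_mem_nhds (Metric.ball_mem_nhds (γ t) (half_pos hr))
    obtain ⟨U, hU, hUo, htU⟩ := mem_nhds_iff.1 (inter_mem (h.locallyConst t) h1)
    -- Half the radius: a disc of radius r/2 about a point at distance less than r/2 from γ t stays
    -- in the disc where f t is analytic.
    refine ⟨r / 2, half_pos hr, U, hUo, htU, fun s hs => ⟨(hU hs).1, hb.mono ?_⟩⟩
    have := (hU hs).2
    simp only [mem_preimage, Metric.mem_ball] at this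
    exact Metric.ball_subset_ball' (by linarith)
  choose r hr U hUo hmem hU using hloc
  obtain ⟨F, -, hF⟩ := isCompact_univ.elim_nhds_subcover U fun t _ => (hUo t).mem_nhds (hmem t)
  have hcov : ∀ t, ∃ c ∈ F, t ∈ U c := fun t => by simpa using hF (mem_univ t)
  choose c hcF hc using hcov
  have hne : F.Nonempty := ⟨c 0, hcF 0⟩
  obtain ⟨m, hmF, hm⟩ := F.exists_min_image r hne
  have hana : ∀ t s, s ∈ U (c t) → AnalyticOnNhd ℂ (f (c t)) (Metric.ball (γ s) (r m)) :=
    fun t s hs => (hU _ s hs).2.mono (Metric.ball_subset_ball (hm _ (hcF t)))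
  -- By compactness finitely many germs suffice: t receives the germ of a centre c t whose
  -- neighbourhood contains it, and r m is the least of the finitely many radii.
  refine ⟨r m, hr m, fun t => f (c t), fun t => (hU _ t (hc t)).1.symm,
    fun t => hana t t (hc t), fun t => ?_⟩
  filter_upwards [(hUo (c t)).mem_nhds (hc t)] with s hs
  exact eqOn_ball_of_eventuallyEq (hana s s (hc s)) (hana t s hs) (Metric.mem_ball_self (hr m))
    ((hU _ s (hc s)).1.symm.trans (hU _ s hs).1)

/-- The continuation along the slightly bent path `γ + t w` has the same germs. -/
lemma eventually_shear (hγ : Continuous γ) (h0 : γ 0 = 0) (h : IsContinuation φ γ f) :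
    ∀ᶠ w in 𝓝 (0 : ℂ), ∃ g, IsContinuation φ (shear γ w) g ∧ g 1 =ᶠ[𝓝 (γ 1 + w)] f 1 := by
  obtain ⟨r, hr, g, hgf, hg, hgl⟩ := h.exists_uniform hγ
  have h1 : ∀ᶠ w in 𝓝 (0 : ℂ), g 1 =ᶠ[𝓝 (γ 1 + w)] f 1 := by
    have hc : Tendsto (fun w => γ 1 + w) (𝓝 0) (𝓝 (γ 1)) := by
      have : ContinuousAt (fun w => γ 1 + w) 0 := by fun_prop
      simpa [ContinuousAt] using this
    exact hc.eventually (hgf 1).eventuallyEq_nhds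
  filter_upwards [h1, Metric.ball_mem_nhds (0 : ℂ) hr] with w hw hwr
  -- The bent path never leaves the discs of radius r about γ t, so the family g for γ is also a
  -- continuation along it.
  have hmem : ∀ t, shear γ w t ∈ Metric.ball (γ t) r := fun t => by
    rw [Metric.mem_ball, dist_eq_norm]
    simp only [shear, add_sub_cancel_left, norm_smul, Real.norm_eq_abs]
    rw [abs_of_nonneg t.2.1]
    exact (mul_le_of_le_one_left (norm_nonneg _) t.2.2).trans_lt (by simpa using hwr)
  refine ⟨g, ⟨fun t => hg t _ (hmem t), ?_, fun t => ?_⟩, hw⟩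
  · have := hgf 0
    rw [h0] at this
    exact this.trans h.zero
  · filter_upwards [hgl t] with t' ht'
    exact ht'.eventuallyEq_of_mem (Metric.isOpen_ball.mem_nhds (hmem t'))

lemma restrict (h : IsContinuation φ γ f) (t : I) :
    IsContinuation φ (restrict γ t) fun s => f (t * s) where
  analyticAt s := h.analyticAt _
  zero := by simpa using h.zero
  locallyConst s := by
    have : ContinuousAt (fun s : I => t * s) s := by fun_prop
    exact this.eventually (h.locallyConst (t * s))

end IsContinuation

/-! ### The holomorphic function on X_Ω defined by a continuable germ -/

namespace IsContinuable

variable {Ω : DFS} {φ : ℂ → ℂ} (hφ : IsContinuable Ω φ)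

/-- The analytic continuation of a continuable germ along an allowed path. -/
def cont (γ : AllowedPath Ω) : I → ℂ → ℂ := (hφ.continuation γ.1 γ.2).choose

lemma isContinuation_cont (γ : AllowedPath Ω) : IsContinuation φ γ.1 (hφ.cont γ) :=
  have h := (hφ.continuation γ.1 γ.2).choose_spec
  ⟨h.1, h.2.1, h.2.2⟩

/-- The germ at the end point of an allowed path obtained by analytic continuation. -/
def endGerm (γ : AllowedPath Ω) : ℂ → ℂ := hφ.cont γ 1

lemma analyticAt_endGerm (γ : AllowedPath Ω) : AnalyticAt ℂ (hφ.endGerm γ) (γ.1 1) :=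
  (hφ.isContinuation_cont γ).analyticAt 1

lemma endGerm_eq {γ : AllowedPath Ω} {f : I → ℂ → ℂ} (h : IsContinuation φ γ.1 f) :
    hφ.endGerm γ =ᶠ[𝓝 (γ.1 1)] f 1 :=
  (hφ.isContinuation_cont γ).unique γ.continuous γ.2.zero h 1

lemma endGerm_bend (γ : AllowedPath Ω) :
    ∀ᶠ w in 𝓝 (0 : ℂ), hφ.endGerm (γ.bend w) =ᶠ[𝓝 (γ.1 1 + w)] hφ.endGerm γ := by
  filter_upwards [γ.eventually_bend,
    (hφ.isContinuation_cont γ).eventually_shear γ.continuous γ.2.zero] with w hb hw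
  obtain ⟨g, hg, hg1⟩ := hw
  rw [← hb] at hg
  have := hφ.endGerm_eq hg
  rw [hb, AllowedPath.shear_one] at this
  exact this.trans hg1

lemma endGerm_restrict (γ : AllowedPath Ω) (t : I) :
    hφ.endGerm (γ.restrict t) =ᶠ[𝓝 (γ.1 t)] hφ.cont γ t := by
  have := hφ.endGerm_eq (γ := γ.restrict t) ((hφ.isContinuation_cont γ).restrict t)
  simpa [AllowedPath.restrict, Resurgence.restrict] using this

lemma endGerm_zero : hφ.endGerm (AllowedPath.zero Ω) =ᶠ[𝓝 0] φ := by
  have h1 := hφ.endGerm_restrict (AllowedPath.zero Ω) 0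
  rw [AllowedPath.restrict_zero, (AllowedPath.zero Ω).2.zero] at h1
  exact h1.trans (hφ.isContinuation_cont _).zero

/-- Two allowed paths are equivalent if they lead to the same germ. The quotient is the Riemann
surface of the germ. -/
def germRelation : PathRelation Ω where
  rel :=
    { r := fun γ γ' => γ.1 1 = γ'.1 1 ∧ hφ.endGerm γ =ᶠ[𝓝 (γ.1 1)] hφ.endGerm γ'
      iseqv := ⟨fun _ => ⟨rfl, EventuallyEq.rfl⟩, fun h => ⟨h.1.symm, h.1 ▸ h.2.symm⟩,
        fun h h' => ⟨h.1.trans h'.1, h.2.trans (h.1 ▸ h'.2)⟩⟩ }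
  end_eq _ _ h := h.1
  bend γ γ' h := by
    have hc : Tendsto (fun w => γ.1 1 + w) (𝓝 0) (𝓝 (γ.1 1)) := by
      have : ContinuousAt (fun w => γ.1 1 + w) 0 := by fun_prop
      simpa [ContinuousAt] using this
    filter_upwards [γ.eventually_bend, γ'.eventually_bend, hφ.endGerm_bend γ,
      hφ.endGerm_bend γ', hc.eventually h.2.eventuallyEq_nhds] with w h1 h2 h3 h4 h5
    have e1 : (γ.bend w).1 1 = γ.1 1 + w := by rw [h1, AllowedPath.shear_one]
    have e2 : (γ'.bend w).1 1 = γ'.1 1 + w := by rw [h2, AllowedPath.shear_one]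
    rw [← h.1] at e2 h4
    exact ⟨e1.trans e2.symm, e1.symm ▸ h3.trans (h5.trans h4.symm)⟩
  separated γ γ' h hn := by
    obtain ⟨r, hr, hb⟩ := exists_ball_analyticOnNhd (hφ.analyticAt_endGerm γ)
    obtain ⟨r', hr', hb'⟩ := exists_ball_analyticOnNhd (hφ.analyticAt_endGerm γ')
    rw [← h] at hb'
    have hmin : 0 < min r r' := lt_min hr hr'
    filter_upwards [γ.eventually_bend, hφ.endGerm_bend γ, hφ.endGerm_bend γ',
      Metric.ball_mem_nhds (0 : ℂ) hmin] with w h1 h3 h4 hw hrel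
    -- If the germs agreed at a nearby bent end point, the identity theorem on a common disc would
    -- make them agree at γ(1).
    refine hn ⟨h, ?_⟩
    have e1 : (γ.bend w).1 1 = γ.1 1 + w := by rw [h1, AllowedPath.shear_one]
    rw [← h] at h4
    have h5 := hrel.2
    rw [e1] at h5
    have hm : γ.1 1 + w ∈ Metric.ball (γ.1 1) (min r r') := by simpa [dist_eq_norm] using hw
    exact (eqOn_ball_of_eventuallyEq
      (hb.mono (Metric.ball_subset_ball (min_le_left r r')))
      (hb'.mono (Metric.ball_subset_ball (min_le_right r r'))) hm
      (h3.symm.trans (h5.trans h4))).eventuallyEq_of_mem (Metric.ball_mem_nhds _ hmin)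
  restrict γ t := by
    have ht1 : ∀ t, (γ.restrict t).1 1 = γ.1 t := fun t => by
      simp [AllowedPath.restrict, Resurgence.restrict]
    have hc : Tendsto (fun t' => γ.1 t' - γ.1 t) (𝓝 t) (𝓝 0) := by
      have : ContinuousAt (fun t' => γ.1 t' - γ.1 t) t :=
        (γ.continuous.sub continuous_const).continuousAt
      simpa [ContinuousAt] using this
    filter_upwards [hc.eventually (γ.restrict t).eventually_bend,
      hc.eventually (hφ.endGerm_bend (γ.restrict t)),
      (hφ.isContinuation_cont γ).locallyConst t,
      γ.continuous.continuousAt.eventually (hφ.endGerm_restrict γ t).eventuallyEq_nhds]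
      with t' h1 h2 h3 h4
    have e : ((γ.restrict t).bend (γ.1 t' - γ.1 t)).1 1 = γ.1 t' := by
      rw [h1, AllowedPath.shear_one, ht1]; ring
    rw [ht1, add_sub_cancel] at h2
    refine ⟨(ht1 t').trans e.symm, ?_⟩
    rw [ht1]
    exact (hφ.endGerm_restrict γ t').trans (h3.trans (h4.symm.trans h2.symm))

/-- The equivalence quantifies over all endless surfaces, and the Riemann surface of the germ is one
of them. There a lift ends at the class of its path, so equality of end points is equality of germs.
-/
lemma endGerm_congr {γ γ' : AllowedPath Ω} (h : initialSetoid Ω γ γ') :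
    hφ.endGerm γ (γ.1 1) = hφ.endGerm γ' (γ'.1 1) := by
  have h1 := h.2 hφ.germRelation.surface
  rw [PathRelation.endpoint_surface, PathRelation.endpoint_surface] at h1
  have h2 := hφ.germRelation.pt_eq.1 h1
  rw [← h2.1]
  exact h2.2.self_of_nhds

/-- The holomorphic function on `X_Ω` defined by a continuable germ. -/
def extension : XOmega Ω → ℂ :=
  Quotient.lift (s := initialSetoid Ω) (fun γ => hφ.endGerm γ (γ.1 1))
    fun _ _ h => hφ.endGerm_congr h

/-- The points near the class of γ are the classes of slightly bent paths, and bending leads to the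
same analytic function (`endGerm_bend`). Holomorphy of `extension` follows. -/
lemma extension_eventuallyEq (γ : AllowedPath Ω) :
    hφ.extension =ᶠ[𝓝 ((initialRelation Ω).pt γ)] hφ.endGerm γ ∘ (XOmega Ω).proj := by
  obtain ⟨r, hr, hb⟩ := Metric.eventually_nhds_iff_ball.1
    (γ.eventually_bend.and (hφ.endGerm_bend γ))
  set R := initialRelation Ω
  set ε := min r (PathRelation.radius γ)
  have hε : 0 < ε := lt_min hr (PathRelation.radius_pos γ)
  have ho := R.isOpen_sec_image (γ := γ) (Metric.isOpen_ball (x := γ.1 1) (ε := ε))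
    (Metric.ball_subset_ball (min_le_right _ _))
  refine mem_of_superset (ho.mem_nhds ⟨_, Metric.mem_ball_self hε, R.sec_self γ⟩) ?_
  rintro _ ⟨z, hz, rfl⟩
  have hz' : z - γ.1 1 ∈ Metric.ball (0 : ℂ) r := by
    rw [Metric.mem_ball, dist_eq_norm] at hz
    simpa using hz.trans_le (min_le_left _ _)
  have h1 := (hb _ hz').1
  have h2 := (hb _ hz').2.self_of_nhds
  have e : (γ.bend (z - γ.1 1)).1 1 = z := by rw [h1, AllowedPath.shear_one]; ring
  change hφ.endGerm (γ.bend (z - γ.1 1)) ((γ.bend (z - γ.1 1)).1 1) =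
    hφ.endGerm γ ((γ.bend (z - γ.1 1)).1 1)
  rw [e]
  rwa [add_sub_cancel] at h2

lemma isHolomorphicPullback_extension : IsHolomorphicPullback Ω φ hφ.extension where
  holomorphic x := by
    obtain ⟨γ, rfl⟩ := (initialRelation Ω).exists_pt x
    refine MDifferentiableAt.congr_of_eventuallyEq ?_ (hφ.extension_eventuallyEq γ)
    refine MDifferentiableAt.comp (I' := 𝓘(ℂ, ℂ)) _ ?_
      ((XOmega Ω).proj_localBihol.contMDiff.mdifferentiable (by simp) _)
    exact (hφ.analyticAt_endGerm γ).differentiableAt.mdifferentiableAt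
  germ := by
    refine (hφ.extension_eventuallyEq (AllowedPath.zero Ω)).trans ?_
    have h1 : ContinuousAt (XOmega Ω).proj (XOmega Ω).base :=
      (XOmega Ω).continuous_proj.continuousAt
    have h2 := hφ.endGerm_zero
    rw [← (XOmega Ω).proj_base] at h2
    exact h1.eventually h2

/-- The pull-back of a continuable germ to `X_Ω` exists. -/
lemma isHolomorphicPullback_pullbackGerm (hφ : IsContinuable Ω φ) :
    IsHolomorphicPullback Ω φ (pullbackGerm Ω φ) := by
  have h : ∃ F, IsHolomorphicPullback Ω φ F := ⟨_, hφ.isHolomorphicPullback_extension⟩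
  rw [pullbackGerm, dif_pos h]
  exact h.choose_spec

end IsContinuable

/-! ### Derivatives of maps to and from `X_Ω` and products of such surfaces -/

lemma differentiableOn_finsetProd {ι E : Type*} [NormedAddCommGroup E] [NormedSpace ℂ E]
    {u : Finset ι} {g : ι → E → ℂ} {s : Set E} (hg : ∀ i ∈ u, DifferentiableOn ℂ (g i) s) :
    DifferentiableOn ℂ (fun z => ∏ i ∈ u, g i z) s := by
  classical
  exact fun z hz => (HasFDerivWithinAt.finsetProd fun i hi =>
    (hg i hi z hz).hasFDerivWithinAt).differentiableWithinAt

section Surface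

variable {𝕜 : Type*} [NontriviallyNormedField 𝕜] [NormedSpace 𝕜 ℂ]

/-- The charts of `X_Ω` are restrictions of the projection. -/
lemma hasMFDerivAt_of_proj {Ω : DFS} {G : ℂ → XOmega Ω} {z : ℂ} {h' : ℂ →L[ℂ] ℂ}
    (hc : ContinuousAt G z) (hd : HasFDerivAt (fun y => (XOmega Ω).proj (G y)) h' z) :
    HasMFDerivAt 𝓘(ℂ, ℂ) 𝓘(ℂ, ℂ) G z h' :=
  ⟨hc, hd.hasFDerivWithinAt⟩

/-- A holomorphic function on `X_Ω` is holomorphic along local sections of the projection. -/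
lemma differentiableAt_comp_section {Ω : DFS} {F : XOmega Ω → ℂ}
    (hF : MDifferentiable 𝓘(ℂ, ℂ) 𝓘(ℂ, ℂ) F) {G : ℂ → XOmega Ω} {z : ℂ} (hc : ContinuousAt G z)
    (hd : ∀ᶠ y in 𝓝 z, (XOmega Ω).proj (G y) = y) : DifferentiableAt ℂ (fun y => F (G y)) z := by
  have h1 : HasFDerivAt (fun y => (XOmega Ω).proj (G y)) (ContinuousLinearMap.id ℂ ℂ) z :=
    (hasFDerivAt_id z).congr_of_eventuallyEq hd
  rw [← mdifferentiableAt_iff_differentiableAt]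
  exact (hF (G z)).comp z (hasMFDerivAt_of_proj hc h1).mdifferentiableAt

namespace IterationDiagram

variable {V : Type*} [Fintype V] (T : IterationDiagram V) (Ω : DFS)

/-- The product charts are given by the projections, so the derivative in charts is by definition
that of `productProj ∘ G`. Needed over ℂ for inverse charts and over ℝ for 𝒟(ξ). -/
lemma hasMFDerivAt_product {E : Type*} [NormedAddCommGroup E] [NormedSpace 𝕜 E]
    {G : E → T.ProductSurface Ω} {z : E} {h' : E →L[𝕜] (V → ℂ)} (hc : ContinuousAt G z)
    (hd : HasFDerivAt (fun y => T.productProj Ω (G y)) h' z) :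
    HasMFDerivAt 𝓘(𝕜, E) (productModel 𝕜 V) G z h' :=
  ⟨hc, hd.hasFDerivWithinAt⟩

lemma productProj_extChartAt_symm (x₀ : T.ProductSurface Ω) {z : V → ℂ}
    (hz : z ∈ (extChartAt (productModel ℂ V) x₀).target) :
    T.productProj Ω ((extChartAt (productModel ℂ V) x₀).symm z) = z :=
  (extChartAt (productModel ℂ V) x₀).right_inv hz

omit [Fintype V] in
lemma continuous_productProj : Continuous (T.productProj Ω) :=
  continuous_pi fun v => (XOmega (T.omegaAt Ω v)).continuous_proj.comp (continuous_apply v)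

/-- Tangent vectors are read in charts that are themselves restrictions of this projection, which is
why the derivative is the identity. -/
lemma hasMFDerivAt_productProj (x : T.ProductSurface Ω) :
    HasMFDerivAt (productModel ℂ V) 𝓘(ℂ, V → ℂ) (T.productProj Ω) x
      (ContinuousLinearMap.id ℂ (V → ℂ)) := by
  refine ⟨(T.continuous_productProj Ω).continuousAt, ?_⟩
  refine (hasFDerivWithinAt_id (𝕜 := ℂ) (T.productProj Ω x) _).congr_of_eventuallyEq ?_ ?_
  · have h : (extChartAt (productModel ℂ V) x).target ∈
        𝓝[range (productModel ℂ V)] (extChartAt (productModel ℂ V) x x) :=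
      extChartAt_target_mem_nhdsWithin x
    refine mem_of_superset h fun z hz => ?_
    exact T.productProj_extChartAt_symm Ω x hz
  · exact T.productProj_extChartAt_symm Ω x (mem_extChartAt_target x)

/-- The coefficient of `β_T`. -/
def betaCoeff (f φ : V → ℂ → ℂ) (x : T.ProductSurface Ω) : ℂ :=
  ∏ v, pullbackGerm (T.omegaAt Ω v) (φ v) (x v) *
      f v (T.productProj Ω x v - ∑ u ∈ T.children v, T.productProj Ω x u)

lemma betaForm_apply {n : ℕ} (e : Fin n ≃ T.NonRoot) (f φ : V → ℂ → ℂ) (x : T.ProductSurface Ω)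
    (w : Fin n → V → ℂ) : T.betaForm Ω e f φ x w =
      T.betaCoeff Ω f φ x * Matrix.det (Matrix.of fun j i : Fin n => w j (e i)) := by
  change T.betaCoeff Ω f φ x * Matrix.det (Matrix.of fun j i : Fin n =>
    (mfderiv (productModel ℂ V) 𝓘(ℂ, V → ℂ) (T.productProj Ω) x (w j) : V → ℂ) (e i)) = _
  rw [(T.hasMFDerivAt_productProj Ω x).mfderiv]
  rfl

lemma isOpen_extChartAt_target (x₀ : T.ProductSurface Ω) :
    IsOpen (extChartAt (productModel ℂ V) x₀).target := by
  have : (extChartAt (productModel ℂ V) x₀).target =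
      univ.pi fun v => (chartAt ℂ (x₀ v)).target := by
    ext z
    simp only [extChartAt, OpenPartialHomeomorph.extend, PartialEquiv.trans_target]
    exact ⟨fun h => h.2, fun h => ⟨fun v _ => mem_univ _, h⟩⟩
  rw [this]
  exact isOpen_set_pi finite_univ fun v _ => (chartAt ℂ (x₀ v)).open_target

lemma continuousAt_extChartAt_symm' (x₀ : T.ProductSurface Ω) {z : V → ℂ}
    (hz : z ∈ (extChartAt (productModel ℂ V) x₀).target) :
    ContinuousAt (extChartAt (productModel ℂ V) x₀).symm z :=
  (continuousOn_extChartAt_symm x₀).continuousAt ((T.isOpen_extChartAt_target Ω x₀).mem_nhds hz)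

/-- An inverse chart is a section of the projection, so it pulls β_T back to a scalar function times
a constant alternating form, and only the scalar has to be shown holomorphic. -/
lemma isHolomorphicForm_betaForm {n : ℕ} (e : Fin n ≃ T.NonRoot) {f φ : V → ℂ → ℂ}
    (hf : ∀ v, Differentiable ℂ (f v))
    (hφ : ∀ v, IsHolomorphicPullback (T.omegaAt Ω v) (φ v) (pullbackGerm (T.omegaAt Ω v) (φ v))) :
    IsHolomorphicForm (T.betaForm Ω e f φ) := by
  intro x₀
  have hopen := T.isOpen_extChartAt_target Ω x₀
  set sec := (extChartAt (productModel ℂ V) x₀).symm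
  -- `coordForm` is constant, so the base point 0 is an arbitrary choice.
  let a : (V → ℂ) [⋀^Fin n]→L[ℂ] ℂ := T.coordForm e 0
  have hpb : ∀ z ∈ (extChartAt (productModel ℂ V) x₀).target,
      DForm.pullback (J := 𝓘(ℂ, V → ℂ)) sec (T.betaForm Ω e f φ) z =
        (T.betaCoeff Ω f φ (sec z) • a : (V → ℂ) [⋀^Fin n]→L[ℂ] ℂ) := by
    intro z hz
    have h1 : HasFDerivAt (fun y => T.productProj Ω (sec y)) (ContinuousLinearMap.id ℂ (V → ℂ)) z :=
      (hasFDerivAt_id z).congr_of_eventuallyEq (by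
        filter_upwards [hopen.mem_nhds hz] with y hy
        exact T.productProj_extChartAt_symm Ω x₀ hy)
    have h2 := T.hasMFDerivAt_product Ω (T.continuousAt_extChartAt_symm' Ω x₀ hz) h1
    refine ContinuousAlternatingMap.ext fun w => ?_
    change T.betaForm Ω e f φ (sec z) (fun j => mfderiv 𝓘(ℂ, V → ℂ) (productModel ℂ V) sec z (w j)) = _
    rw [h2.mfderiv]
    exact T.betaForm_apply Ω e f φ (sec z) w
  refine DifferentiableOn.congr (f := fun z =>
    (T.betaCoeff Ω f φ (sec z) • a : (V → ℂ) [⋀^Fin n]→L[ℂ] ℂ)) ?_ hpb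
  refine DifferentiableOn.smul_const (𝕜 := ℂ) (E := V → ℂ)
    (F := (V → ℂ) [⋀^Fin n]→L[ℂ] ℂ) (𝕜' := ℂ) ?_ a
  unfold betaCoeff
  refine differentiableOn_finsetProd fun v _ => ?_
  refine DifferentiableOn.mul (fun z hz => ?_) ?_
  · have hzv : z v ∈ (chartAt ℂ (x₀ v)).target := hz.2 v (mem_univ v)
    have h1 : DifferentiableAt ℂ (fun y => pullbackGerm (T.omegaAt Ω v) (φ v)
        ((chartAt ℂ (x₀ v)).symm y)) (z v) := by
      refine differentiableAt_comp_section (hφ v).holomorphic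
        ((chartAt ℂ (x₀ v)).continuousAt_symm hzv) ?_
      filter_upwards [(chartAt ℂ (x₀ v)).open_target.mem_nhds hzv] with y hy
      exact (chartAt ℂ (x₀ v)).right_inv hy
    exact (h1.comp z (f := fun z : V → ℂ => z v) (differentiableAt_apply v z)).differentiableWithinAt
  · refine DifferentiableOn.congr (f := fun z : V → ℂ => f v (z v - ∑ u ∈ T.children v, z u)) ?_ ?_
    · refine Differentiable.differentiableOn ((hf v).comp ?_)
      fun_prop
    · intro z hz
      rw [T.productProj_extChartAt_symm Ω x₀ hz]

end IterationDiagram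

end Surface

/-! ### The disc `D_{ρ(Ω)}` and the lifts of rays -/

namespace DFS

variable (Ω : DFS)

lemma mem_disc_iff {ζ : ℂ} : ζ ∈ Ω.disc ↔ ∃ r : ℝ≥0, Ω r = ∅ ∧ ‖ζ‖₊ < r := by
  simp only [disc, rho, mem_ofPred_eq, lt_sSup_iff]
  constructor
  · rintro ⟨_, ⟨r, hr, rfl⟩, h⟩
    exact ⟨r, hr, ENNReal.coe_lt_coe.1 h⟩
  · rintro ⟨r, hr, h⟩
    exact ⟨_, ⟨r, hr, rfl⟩, ENNReal.coe_lt_coe.2 h⟩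

lemma isOpen_disc : IsOpen Ω.disc := by
  have h : Continuous fun ζ : ℂ => (‖ζ‖₊ : ℝ≥0∞) := by fun_prop
  exact isOpen_Iio.preimage h

lemma zero_mem_disc : (0 : ℂ) ∈ Ω.disc := by
  obtain ⟨δ, hδ, h⟩ := Ω.empty'
  exact Ω.mem_disc_iff.2 ⟨δ, h, by simpa using hδ⟩

lemma starConvex_disc : StarConvex ℝ 0 Ω.disc := by
  rw [starConvex_zero_iff]
  intro ζ hζ a ha ha'
  obtain ⟨r, hr, h⟩ := Ω.mem_disc_iff.1 hζ
  refine Ω.mem_disc_iff.2 ⟨r, hr, lt_of_le_of_lt ?_ h⟩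
  rw [← NNReal.coe_le_coe, coe_nnnorm, coe_nnnorm, norm_smul, Real.norm_eq_abs, abs_of_nonneg ha]
  exact mul_le_of_le_one_left (norm_nonneg _) ha'

/-- In a decomposition L₁ + L₂ = r both levels are at most r, where Ω has no points to contribute.
Hence all the discs of the Ω_v contain that of Ω. -/
lemma nsum_eq_empty {r : ℝ≥0} (h : Ω r = ∅) (w : ℕ) : Ω.nsum w r = ∅ := by
  have hle : ∀ l ≤ r, Ω l = ∅ := fun l hl => subset_empty_iff.1 (h ▸ Ω.mono' _ _ hl)
  induction w with
  | zero => rfl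
  | succ w ih =>
    refine eq_empty_of_forall_notMem ?_
    rintro z ((⟨l₁, l₂, hl, a, ha, b, hb, rfl⟩ | hz) | hz)
    · rw [hle l₂ (hl ▸ le_add_self)] at hb
      exact hb
    · rw [ih] at hz
      exact hz
    · rw [h] at hz
      exact hz

lemma disc_subset_disc_nsum (w : ℕ) : Ω.disc ⊆ (Ω.nsum w).disc := fun ζ hζ => by
  obtain ⟨r, hr, h⟩ := Ω.mem_disc_iff.1 hζ
  exact (Ω.nsum w).mem_disc_iff.2 ⟨r, Ω.nsum_eq_empty hr w, h⟩

end DFS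

lemma isAllowed_ray {Ω : DFS} {ζ : ℂ} (hζ : ζ ∈ Ω.disc) : IsAllowed Ω (ray ζ) := by
  refine ⟨⟨_, lipschitz_ray ζ⟩, by simp [ray], fun t hc => ?_⟩
  obtain ⟨r, hr, h⟩ := Ω.mem_disc_iff.1 hζ
  -- The ray is the constant path bent by ζ, which bounds its length by |ζ| < r. It thus stays below
  -- level r, where Ω is empty.
  have hlen : pathLength (ray ζ) t ≤ ‖ζ‖₊ := by
    have h1 := pathLength_shear_le (γ := fun _ => 0) (LipschitzWith.const (0 : ℂ)) ζ t
    have h2 : pathLength (fun _ : I => (0 : ℂ)) t = 0 := by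
      unfold pathLength
      rw [eVariationOn.constant_on]
      · rfl
      · rintro _ ⟨_, _, rfl⟩ _ ⟨_, _, rfl⟩; rfl
    have h3 : shear (fun _ : I => (0 : ℂ)) ζ = ray ζ := by ext t; simp [shear, ray]
    rwa [h2, zero_add, h3] at h1
  obtain ⟨x, hx, hxS⟩ := mem_closure_iff.1 hc (Prod.fst ⁻¹' Iio r)
    (isOpen_Iio.preimage continuous_fst) (hlen.trans_lt h)
  have : x.2 ∈ Ω r := Ω.mono' _ _ (le_of_lt hx) hxS
  rw [hr] at this
  exact this

lemma rayLift_eq {Ω : DFS} {ζ : ℂ} (h : IsAllowed Ω (ray ζ)) :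
    rayLift Ω ζ = (XOmega Ω).endpoint ⟨_, h⟩ := by
  rw [rayLift, dif_pos h]
  rfl

lemma proj_rayLift {Ω : DFS} {ζ : ℂ} (hζ : ζ ∈ Ω.disc) : (XOmega Ω).proj (rayLift Ω ζ) = ζ := by
  rw [rayLift_eq (isAllowed_ray hζ), EndlessSurface.proj_endpoint]
  simp [ray]

lemma rayLift_zero (Ω : DFS) : rayLift Ω 0 = (XOmega Ω).base := by
  have h : ray 0 = (AllowedPath.zero Ω).1 := by
    ext t
    simp [ray, AllowedPath.zero]
  rw [rayLift_eq (isAllowed_ray Ω.zero_mem_disc)]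
  have h2 : (⟨ray 0, isAllowed_ray Ω.zero_mem_disc⟩ : AllowedPath Ω) = AllowedPath.zero Ω :=
    Subtype.ext h
  rw [h2, ← AllowedPath.restrict_zero (AllowedPath.zero Ω), EndlessSurface.endpoint_restrict,
    EndlessSurface.lift_zero]

/-- Bending the ray to ζ by y - ζ gives the ray to y, so this is the continuity of the end points of
bent paths. -/
lemma continuousAt_rayLift {Ω : DFS} {ζ : ℂ} (hζ : ζ ∈ Ω.disc) : ContinuousAt (rayLift Ω) ζ := by
  set γ : AllowedPath Ω := ⟨ray ζ, isAllowed_ray hζ⟩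
  obtain ⟨r, hr, hc, hb⟩ := (XOmega Ω).exists_continuousOn_endpoint γ
  have h1 : ContinuousAt (fun w => (XOmega Ω).endpoint (γ.bend w)) (ζ - ζ) := by
    rw [sub_self]
    exact hc.continuousAt (Metric.ball_mem_nhds _ hr)
  have h2 : ContinuousAt (fun y => (XOmega Ω).endpoint (γ.bend (y - ζ))) ζ :=
    ContinuousAt.comp (f := fun y => y - ζ) h1 (by fun_prop)
  refine h2.congr ?_
  filter_upwards [Metric.ball_mem_nhds ζ hr, Ω.isOpen_disc.mem_nhds hζ] with y hy hyd
  have h3 := hb (y - ζ) (by simpa [dist_eq_norm] using hy)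
  have h4 : γ.bend (y - ζ) = ⟨ray y, isAllowed_ray hyd⟩ := by
    refine Subtype.ext (h3.trans ?_)
    ext t
    simp only [shear, ray, γ, smul_sub]
    ring
  rw [h4, rayLift_eq (isAllowed_ray hyd)]

/-- The holomorphic extension of a continuable germ to the disc `D_{ρ(Ω)}`. -/
def discExtension (Ω : DFS) (φ : ℂ → ℂ) (ζ : ℂ) : ℂ := pullbackGerm Ω φ (rayLift Ω ζ)

lemma IsHolomorphicPullback.differentiableOn_discExtension {Ω : DFS} {φ : ℂ → ℂ}
    (h : IsHolomorphicPullback Ω φ (pullbackGerm Ω φ)) :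
    DifferentiableOn ℂ (discExtension Ω φ) Ω.disc := fun ζ hζ => by
  refine (differentiableAt_comp_section h.holomorphic (continuousAt_rayLift hζ)
    ?_).differentiableWithinAt
  filter_upwards [Ω.isOpen_disc.mem_nhds hζ] with y hy
  exact proj_rayLift hy

lemma IsHolomorphicPullback.discExtension_eventuallyEq {Ω : DFS} {φ : ℂ → ℂ}
    (h : IsHolomorphicPullback Ω φ (pullbackGerm Ω φ)) : discExtension Ω φ =ᶠ[𝓝 0] φ := by
  have h1 := continuousAt_rayLift Ω.zero_mem_disc
  have h2 := h.germ
  rw [← rayLift_zero] at h2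
  filter_upwards [h1.eventually h2, Ω.isOpen_disc.mem_nhds Ω.zero_mem_disc] with y hy hyd
  rw [discExtension, hy, Function.comp, proj_rayLift hyd]

/-! ### The pull-back of `β_T` -/

namespace IterationDiagram

variable {V : Type*} [Fintype V] (T : IterationDiagram V) (Ω : DFS)

lemma withRoot_root (s : T.NonRoot → ℝ) : T.withRoot s T.root = 1 := by simp [withRoot]

variable {T} in
-- Along the path from v to the root the coordinates do not decrease: each is one of the nonnegative
-- terms of a sum bounded by the next. At the root the value is 1.
lemma simplex_le_one {s : V → ℝ} (hs : s ∈ T.simplex) (v : V) : s v ≤ 1 := by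
  induction T.reaches_root v using Relation.ReflTransGen.head_induction_on with
  | refl => exact hs.2.2.le
  | @head u w h _ ih =>
    refine (Finset.single_le_sum (f := s) (fun x _ => hs.1 x) (T.mem_children.2 h)).trans ?_
    exact (hs.2.1 w).trans ih

lemma continuous_withRoot : Continuous T.withRoot := by
  refine continuous_pi fun v => ?_
  by_cases h : v ≠ T.root
  · simpa [withRoot, h] using continuous_apply (⟨v, h⟩ : T.NonRoot)
  · simpa [withRoot, h] using continuous_const

lemma isClosed_simplex : IsClosed T.simplex := by
  have h : T.simplex = (⋂ v, {s | 0 ≤ s v}) ∩ (⋂ v, {s | ∑ u ∈ T.children v, s u ≤ s v}) ∩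
      {s | s T.root = 1} := by
    ext s
    simp [simplex, and_assoc]
  rw [h]
  refine ((isClosed_iInter fun v => ?_).inter (isClosed_iInter fun v => ?_)).inter ?_
  · exact isClosed_le continuous_const (continuous_apply v)
  · exact isClosed_le (by fun_prop) (continuous_apply v)
  · exact isClosed_eq (continuous_apply _) continuous_const

lemma measurableSet_simplexCoords : MeasurableSet T.simplexCoords :=
  (T.isClosed_simplex.preimage T.continuous_withRoot).measurableSet

variable {Ω} in
lemma smul_mem_disc_omegaAt {ξ : ℂ} (hξ : ξ ∈ Ω.disc) {s : V → ℝ} (hs : s ∈ T.simplex) (v : V) :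
    s v • ξ ∈ (T.omegaAt Ω v).disc :=
  Ω.disc_subset_disc_nsum _ (Ω.starConvex_disc.smul_mem hξ (hs.1 v) (simplex_le_one hs v))

variable {Ω} in
-- Followed by the projections, 𝒟(ξ) is the linear map s ↦ (s_v ξ)_v. As the discs are open this
-- holds on a full neighbourhood of s in ℝ^V, even when s is on the boundary of Δ_T.
lemma hasMFDerivAt_D {ξ : ℂ} (hξ : ξ ∈ Ω.disc) {s : V → ℝ} (hs : s ∈ T.simplex) :
    HasMFDerivAt 𝓘(ℝ, V → ℝ) (productModel ℝ V) (T.D Ω ξ) s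
      (ContinuousLinearMap.pi fun v : V =>
        (ContinuousLinearMap.proj (R := ℝ) (φ := fun _ : V => ℝ) v).smulRight ξ) := by
  have hc : ∀ v, ContinuousAt (fun s : V → ℝ => s v • ξ) s := fun v =>
    ((continuous_apply v).smul continuous_const).continuousAt
  refine T.hasMFDerivAt_product Ω (continuousAt_pi.2 fun v => ?_) (hasFDerivAt_pi.2 fun v => ?_)
  · exact ContinuousAt.comp (f := fun s : V → ℝ => s v • ξ)
      (continuousAt_rayLift (T.smul_mem_disc_omegaAt hξ hs v)) (hc v)
  · refine HasFDerivAt.congr_of_eventuallyEq (f := fun s : V → ℝ => s v • ξ) ?_ ?_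
    · exact ((ContinuousLinearMap.proj (R := ℝ) (φ := fun _ : V => ℝ) v).smulRight ξ).hasFDerivAt
    · filter_upwards [(hc v).preimage_mem_nhds ((T.omegaAt Ω v).isOpen_disc.mem_nhds
        (T.smul_mem_disc_omegaAt hξ hs v))] with y hy
      exact proj_rayLift hy

variable {Ω} in
lemma coefficient_pullback_D {n : ℕ} (e : Fin n ≃ T.NonRoot) (f φ : V → ℂ → ℂ) {ξ : ℂ}
    (hξ : ξ ∈ Ω.disc) {s : T.NonRoot → ℝ} (hs : s ∈ T.simplexCoords) :
    T.coefficient e ((T.toRealForm Ω (T.betaForm Ω e f φ)).pullback (T.D Ω ξ)) s =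
      (∏ v, discExtension (T.omegaAt Ω v) (φ v) (T.withRoot s v • ξ) *
        f v ((T.withRoot s v - ∑ u ∈ T.children v, T.withRoot s u) • ξ)) * ξ ^ n := by
  classical
  change T.betaForm Ω e f φ (T.D Ω ξ (T.withRoot s)) (fun i =>
    mfderiv 𝓘(ℝ, V → ℝ) (productModel ℝ V) (T.D Ω ξ) (T.withRoot s)
      (Pi.single (e i : V) (1 : ℝ) : V → ℝ)) = _
  rw [(T.hasMFDerivAt_D hξ hs).mfderiv]
  refine (T.betaForm_apply Ω e f φ _ _).trans ?_
  congr 1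
  · refine Finset.prod_congr rfl fun v _ => ?_
    have h : ∀ v, T.productProj Ω (T.D Ω ξ (T.withRoot s)) v = T.withRoot s v • ξ := fun v =>
      proj_rayLift (T.smul_mem_disc_omegaAt hξ hs v)
    simp only [h, ← Finset.sum_smul, ← sub_smul]
    rfl
  -- The derivative of 𝒟(ξ) multiplies coordinate vectors by ξ, so the determinant is that of ξ
  -- times the identity matrix of size n, the number of non-root vertices.
  · have h : (Matrix.of fun j i : Fin n => (ContinuousLinearMap.pi fun v : V =>
        (ContinuousLinearMap.proj (R := ℝ) (φ := fun _ : V => ℝ) v).smulRight ξ)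
        (Pi.single (e j : V) (1 : ℝ) : V → ℝ) (e i : V)) = Matrix.diagonal fun _ => ξ := by
      ext j i
      by_cases hij : i = j
      · subst hij
        simp
      · have : (e i : V) ≠ e j := fun h => hij (e.injective (Subtype.ext h))
        simp [Pi.single_eq_of_ne this, Matrix.diagonal_apply_ne _ (Ne.symm hij)]
    refine (congrArg Matrix.det h).trans ?_
    simp

end IterationDiagram

/-! ### Convolution of holomorphic functions -/

lemma differentiableOn_intervalIntegral {U : Set ℂ} (hU : IsOpen U) {F F' : ℂ → ℝ → ℂ}
    (hF : ∀ z ∈ U, ContinuousOn (F z) (Icc 0 1))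
    (hF' : ContinuousOn (fun x : ℂ × ℝ => F' x.1 x.2) (U ×ˢ Icc 0 1))
    (hd : ∀ z ∈ U, ∀ t ∈ Icc (0 : ℝ) 1, HasDerivAt (fun z => F z t) (F' z t) z) :
    DifferentiableOn ℂ (fun z => ∫ t in (0 : ℝ)..1, F z t) U := by
  intro z hz
  obtain ⟨ε, hε, hb⟩ := Metric.nhds_basis_closedBall.mem_iff.1 (hU.mem_nhds hz)
  -- Differentiation under the integral sign: the derivative is bounded on a compact ball times [0,
  -- 1], and this constant dominates.
  obtain ⟨C, hC⟩ := ((isCompact_closedBall z ε).prod (isCompact_Icc (a := (0 : ℝ)) (b := 1))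
    ).exists_bound_of_continuousOn (hF'.mono (prod_mono hb le_rfl))
  have huI : Set.uIoc (0 : ℝ) 1 ⊆ Icc 0 1 := by
    rw [uIoc_of_le zero_le_one]
    exact Ioc_subset_Icc_self
  have hmeas : ∀ {g : ℝ → ℂ}, ContinuousOn g (Icc 0 1) → MeasureTheory.AEStronglyMeasurable g
      (MeasureTheory.volume.restrict (Set.uIoc (0 : ℝ) 1)) := fun hg =>
    (hg.mono huI).aestronglyMeasurable measurableSet_uIoc
  have := intervalIntegral.hasDerivAt_integral_of_dominated_loc_of_deriv_le
    (μ := MeasureTheory.volume) (a := 0) (b := 1) (F := F) (F' := F') (x₀ := z)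
    (bound := fun _ => C) (Metric.closedBall_mem_nhds z hε) ?_ ?_ ?_ ?_ ?_ ?_
  · exact this.2.differentiableAt.differentiableWithinAt
  · filter_upwards [hU.mem_nhds hz] with y hy
    exact hmeas (hF y hy)
  · exact ContinuousOn.intervalIntegrable (by rw [uIcc_of_le zero_le_one]; exact hF z hz)
  · exact hmeas (hF'.comp (f := fun t => (z, t)) (by fun_prop) fun t ht => ⟨hz, ht⟩)
  · exact Eventually.of_forall fun t ht y hy => hC (y, t) ⟨hy, huI ht⟩
  · exact intervalIntegrable_const
  · exact Eventually.of_forall fun t ht y hy => hd y (hb hy) t (huI ht)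

lemma sub_smul_self_eq (t : ℝ) (z : ℂ) : z - t • z = (1 - t) • z := by rw [sub_smul, one_smul]

lemma conv_eq (f g : ℂ → ℂ) (ξ : ℂ) :
    conv f g ξ = ∫ t in (0 : ℝ)..1, f ((1 - t) • ξ) * g (t • ξ) * ξ := by
  simp only [conv, sub_smul_self_eq]

lemma conv_congr {f f' g g' : ℂ → ℂ} {U : Set ℂ} (hs : StarConvex ℝ 0 U) (hf : EqOn f f' U)
    (hg : EqOn g g' U) : EqOn (conv f g) (conv f' g') U := fun z hz => by
  rw [conv_eq, conv_eq]
  refine intervalIntegral.integral_congr fun t ht => ?_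
  rw [uIcc_of_le zero_le_one] at ht
  simp only [hf (hs.smul_mem hz (sub_nonneg.2 ht.2) (sub_le_self _ ht.1)),
    hg (hs.smul_mem hz ht.1 ht.2)]

/-- With the parameter t ∈ [0, 1] the domain of integration no longer depends on z, and (1 - t) z
and t z remain in the star-shaped U; the integral is then differentiated under the sign. -/
lemma DifferentiableOn.conv {f g : ℂ → ℂ} {U : Set ℂ} (hU : IsOpen U) (hs : StarConvex ℝ 0 U)
    (hf : DifferentiableOn ℂ f U) (hg : DifferentiableOn ℂ g U) :
    DifferentiableOn ℂ (conv f g) U := by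
  have hm1 : MapsTo (fun x : ℂ × ℝ => (1 - x.2) • x.1) (U ×ˢ Icc 0 1) U := fun x hx =>
    hs.smul_mem hx.1 (sub_nonneg.2 hx.2.2) (sub_le_self _ hx.2.1)
  have hm2 : MapsTo (fun x : ℂ × ℝ => x.2 • x.1) (U ×ˢ Icc 0 1) U := fun x hx =>
    hs.smul_mem hx.1 hx.2.1 hx.2.2
  have hc1 : ContinuousOn (fun x : ℂ × ℝ => (1 - x.2) • x.1) (U ×ˢ Icc 0 1) := by fun_prop
  have hc2 : ContinuousOn (fun x : ℂ × ℝ => x.2 • x.1) (U ×ˢ Icc 0 1) := by fun_prop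
  have hf1 := hf.continuousOn.comp hc1 hm1
  have hg1 := hg.continuousOn.comp hc2 hm2
  have hf2 := (hf.deriv hU).continuousOn.comp hc1 hm1
  have hg2 := (hg.deriv hU).continuousOn.comp hc2 hm2
  have hc3 : ContinuousOn (fun x : ℂ × ℝ => x.1) (U ×ˢ Icc 0 1) := by fun_prop
  have hc4 : ContinuousOn (fun x : ℂ × ℝ => (x.2 : ℂ)) (U ×ˢ Icc 0 1) := by fun_prop
  refine (differentiableOn_intervalIntegral hU
    (F := fun z t => f ((1 - t) • z) * g (t • z) * z)
    (F' := fun z t => (deriv f ((1 - t) • z) * (1 - t) * g (t • z) +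
      f ((1 - t) • z) * (deriv g (t • z) * t)) * z + f ((1 - t) • z) * g (t • z))
    ?_ ?_ ?_).congr fun z _ => conv_eq f g z
  · intro z hz
    exact ((hf1.mul hg1).mul hc3).comp (f := fun t => (z, t)) (by fun_prop) fun t ht => ⟨hz, ht⟩
  · exact ((((hf2.mul (continuousOn_const.sub hc4)).mul hg1).add
      (hf1.mul (hg2.mul hc4))).mul hc3).add (hf1.mul hg1)
  · intro z hz t ht
    have hline : ∀ a : ℝ, HasDerivAt (fun z : ℂ => a • z) (a : ℂ) z := fun a => by
      simpa using (hasDerivAt_id z).const_mul (a : ℂ)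
    have h1 : HasDerivAt (fun z => f ((1 - t) • z)) (deriv f ((1 - t) • z) * (1 - t)) z := by
      have := (hf.differentiableAt (hU.mem_nhds (hm1 (x := (z, t)) ⟨hz, ht⟩))).hasDerivAt
      exact (this.comp z (hline (1 - t))).congr_deriv (by push_cast; rfl)
    have h2 : HasDerivAt (fun z => g (t • z)) (deriv g (t • z) * t) z := by
      have := (hg.differentiableAt (hU.mem_nhds (hm2 (x := (z, t)) ⟨hz, ht⟩))).hasDerivAt
      exact this.comp z (hline t)
    exact ((h1.mul h2).mul (hasDerivAt_id z)).congr_deriv (by simp)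

lemma differentiableOn_convMul {x y : ℂ × (ℂ → ℂ)} {U : Set ℂ} (hU : IsOpen U)
    (hs : StarConvex ℝ 0 U) (hx : DifferentiableOn ℂ x.2 U) (hy : DifferentiableOn ℂ y.2 U) :
    DifferentiableOn ℂ (convMul x y).2 U :=
  ((hy.const_mul _).add (hx.const_mul _)).add (DifferentiableOn.conv hU hs hx hy)

lemma differentiableOn_convProd {l : List (ℂ → ℂ)} {U : Set ℂ} (hU : IsOpen U)
    (hs : StarConvex ℝ 0 U) (hl : ∀ g ∈ l, DifferentiableOn ℂ g U) :
    DifferentiableOn ℂ (convProd l).2 U := by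
  induction l with
  | nil => exact differentiableOn_const 0
  | cons g l ih =>
    exact differentiableOn_convMul hU hs (hl g (by simp)) (ih fun h hh => hl h (by simp [hh]))

lemma convMul_congr {a b : ℂ} {f f' g g' : ℂ → ℂ} {U : Set ℂ} (hs : StarConvex ℝ 0 U)
    (hf : EqOn f f' U) (hg : EqOn g g' U) :
    EqOn (convMul (a, f) (b, g)).2 (convMul (a, f') (b, g')).2 U := fun z hz => by
  simp only [convMul, hf hz, hg hz, conv_congr hs hf hg hz]

lemma convProd_congr {ι : Type*} {l : List ι} {g g' : ι → ℂ → ℂ} {U : Set ℂ}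
    (hs : StarConvex ℝ 0 U) (h : ∀ i ∈ l, EqOn (g i) (g' i) U) :
    (convProd (l.map g)).1 = (convProd (l.map g')).1 ∧
      EqOn (convProd (l.map g)).2 (convProd (l.map g')).2 U := by
  induction l with
  | nil => exact ⟨rfl, fun _ _ => rfl⟩
  | cons i l ih =>
    obtain ⟨h1, h2⟩ := ih fun j hj => h j (by simp [hj])
    have h3 := convMul_congr (a := 0) (b := (convProd (l.map g')).1) hs (h i (by simp)) h2
    refine ⟨?_, ?_⟩
    · change 0 * _ = 0 * _
      rw [zero_mul, zero_mul]
    · change EqOn (convMul (0, g i) ((convProd (l.map g)).1, (convProd (l.map g)).2)).2 _ U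
      rw [h1]
      exact h3

/-! ### Iterated convolutions on star-shaped domains -/

namespace IterationDiagram

variable {V : Type*} [Fintype V] (T : IterationDiagram V)

lemma differentiableOn_psi {f φ : V → ℂ → ℂ} {U : Set ℂ} (hU : IsOpen U)
    (hs : StarConvex ℝ 0 U) (hf : ∀ v, DifferentiableOn ℂ (f v) U)
    (hφ : ∀ v, DifferentiableOn ℂ (φ v) U) (v : V) : DifferentiableOn ℂ (T.psi f φ v) U := by
  induction v using T.wellFounded_adj.induction with
  | _ v ih =>
    rw [psi_eq]
    refine (hφ v).mul (differentiableOn_convMul hU hs (hf v) (differentiableOn_convProd hU hs ?_))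
    intro g hg
    obtain ⟨u, hu, rfl⟩ := List.mem_map.1 hg
    exact ih u (T.mem_children.1 (Finset.mem_toList.1 hu))

/-- On a star-shaped set a convolution only sees the values of its factors in that set. On a small
disc this permits exchanging each φ_v for its extension. -/
lemma psi_congr (f : V → ℂ → ℂ) {φ φ' : V → ℂ → ℂ} {U : Set ℂ} (hs : StarConvex ℝ 0 U)
    (hφ : ∀ v, EqOn (φ v) (φ' v) U) (v : V) : EqOn (T.psi f φ v) (T.psi f φ' v) U := by
  induction v using T.wellFounded_adj.induction with
  | _ v ih =>
    intro z hz
    obtain ⟨h1, h2⟩ := convProd_congr (l := (T.children v).toList) hs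
      fun u hu => ih u (T.mem_children.1 (Finset.mem_toList.1 hu))
    have h3 := convMul_congr (a := 0) (b := (convProd ((T.children v).toList.map (T.psi f φ'))).1)
      hs (fun z _ => rfl : EqOn (f v) (f v) U) h2 hz
    rw [psi_eq, psi_eq]
    dsimp only
    rw [hφ v hz, ← h3, ← h1]

end IterationDiagram

/-! ### Causal functions on the line -/

open MeasureTheory

/-- Bounded, measurable and integrable functions on the line that vanish on the negative axis. -/
structure CausalFun where
  toFun : ℝ → ℂ
  measurable' : Measurable toFun
  bounded' : ∃ C, ∀ x, ‖toFun x‖ ≤ C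
  integrable' : Integrable toFun
  zero_of_neg' : ∀ x < 0, toFun x = 0

namespace CausalFun

instance : CoeFun CausalFun fun _ => ℝ → ℂ := ⟨CausalFun.toFun⟩

@[ext] lemma ext {f g : CausalFun} (h : ∀ x, f x = g x) : f = g := by
  cases f; cases g; congr; exact funext h

@[fun_prop] lemma measurable (f : CausalFun) : Measurable (f : ℝ → ℂ) := f.measurable'
lemma integrable (f : CausalFun) : Integrable (f : ℝ → ℂ) := f.integrable'
lemma zero_of_neg (f : CausalFun) {x : ℝ} (h : x < 0) : f x = 0 := f.zero_of_neg' x h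

/-- A bound for a causal function. -/
def bound (f : CausalFun) : ℝ := f.bounded'.choose

lemma norm_le_bound (f : CausalFun) (x : ℝ) : ‖f x‖ ≤ f.bound := f.bounded'.choose_spec x

/-- The convolution product of two causal functions, multiplied by `ξ`. -/
def conv (ξ : ℂ) (f g : CausalFun) : CausalFun where
  toFun t := (∫ x, f (t - x) * g x) * ξ
  measurable' := by
    have h : Measurable fun p : ℝ × ℝ => f (p.1 - p.2) * g p.2 := by fun_prop
    exact h.stronglyMeasurable.integral_prod_right'.measurable.mul_const ξ
  bounded' := by
    refine ⟨(∫ x, f.bound * ‖g x‖) * ‖ξ‖, fun t => ?_⟩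
    rw [norm_mul]
    refine mul_le_mul_of_nonneg_right ?_ (norm_nonneg _)
    refine norm_integral_le_of_norm_le (g.integrable.norm.const_mul _) (ae_of_all _ fun x => ?_)
    rw [norm_mul]
    exact mul_le_mul_of_nonneg_right (f.norm_le_bound _) (norm_nonneg _)
  integrable' := by
    have h := f.integrable.integrable_convolution (ContinuousLinearMap.mul ℝ ℂ) g.integrable
    refine Integrable.mul_const (h.congr (ae_of_all _ fun t => ?_)) ξ
    rw [convolution_eq_swap]
    rfl
  zero_of_neg' t ht := by
    have h : ∀ x, f (t - x) * g x = 0 := fun x => by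
      rcases lt_or_ge x 0 with hx | hx
      · rw [g.zero_of_neg hx, mul_zero]
      · rw [f.zero_of_neg (by linarith), zero_mul]
    simp [h]

lemma conv_apply (ξ : ℂ) (f g : CausalFun) (t : ℝ) :
    conv ξ f g t = (∫ x, f (t - x) * g x) * ξ := rfl

/-- Fubini: both sides are double integrals of a bounded function of f times the integrable g ⊗ h.
This makes folding over a multiset meaningful, so that a product over children needs no order. -/
lemma conv_right_comm (ξ : ℂ) (f g h : CausalFun) :
    conv ξ (conv ξ f g) h = conv ξ (conv ξ f h) g := by
  have key : ∀ (g h : CausalFun) (t : ℝ), conv ξ (conv ξ f g) h t =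
      (∫ y, ∫ x, f (t - y - x) * (g x * h y)) * (ξ * ξ) := fun g h t => by
    rw [conv_apply, ← mul_assoc]
    refine congrArg (· * ξ) ?_
    rw [← integral_mul_const]
    refine integral_congr_ae (ae_of_all _ fun y => ?_)
    dsimp only
    rw [conv_apply, mul_right_comm, ← integral_mul_const]
    simp only [mul_assoc]
  ext t
  rw [key, key, integral_integral_swap]
  · congr 1
    refine integral_congr_ae (ae_of_all _ fun y => integral_congr_ae (ae_of_all _ fun x => ?_))
    dsimp only
    rw [sub_right_comm, mul_comm (g y)]
  · refine Integrable.bdd_mul (c := f.bound) (f := fun p : ℝ × ℝ => f (t - p.1 - p.2))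
      (g := fun p : ℝ × ℝ => g p.2 * h p.1) ?_ ?_ (ae_of_all _ fun p => f.norm_le_bound _)
    · exact (h.integrable.mul_prod g.integrable).congr (ae_of_all _ fun p => mul_comm _ _)
    · exact Measurable.aestronglyMeasurable (by fun_prop)

/-- After a translation of the inner variable on the right, the two sides integrate f(t - y) h(x)
g(y - x) in the two orders; f is bounded and the rest is integrable on the plane. -/
lemma conv_assoc (ξ : ℂ) (f g h : CausalFun) :
    conv ξ f (conv ξ g h) = conv ξ (conv ξ f g) h := by
  ext t
  have h1 : conv ξ f (conv ξ g h) t =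
      (∫ y, ∫ x, f (t - y) * (h x * g (y - x))) * (ξ * ξ) := by
    rw [conv_apply, ← mul_assoc]
    refine congrArg (· * ξ) ?_
    rw [← integral_mul_const]
    refine integral_congr_ae (ae_of_all _ fun y => ?_)
    dsimp only
    rw [conv_apply, ← mul_assoc, ← integral_const_mul]
    simp only [mul_comm (h _)]
  have h2 : conv ξ (conv ξ f g) h t =
      (∫ x, ∫ y, f (t - y) * (h x * g (y - x))) * (ξ * ξ) := by
    rw [conv_apply, ← mul_assoc]
    refine congrArg (· * ξ) ?_
    rw [← integral_mul_const]
    refine integral_congr_ae (ae_of_all _ fun x => ?_)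
    dsimp only
    rw [conv_apply, mul_right_comm, ← integral_mul_const]
    rw [← integral_sub_right_eq_self (fun y => f (t - x - y) * g y * h x) x]
    refine congrArg (· * ξ) (integral_congr_ae (ae_of_all _ fun y => ?_))
    dsimp only
    rw [sub_sub_sub_cancel_right, mul_assoc, mul_comm (h x)]
  rw [h1, h2, integral_integral_swap]
  refine Integrable.bdd_mul (c := f.bound) (f := fun p : ℝ × ℝ => f (t - p.1))
      (g := fun p : ℝ × ℝ => h p.2 * g (p.1 - p.2)) ?_ ?_ (ae_of_all _ fun p => f.norm_le_bound _)
  · exact h.integrable.convolution_integrand (ContinuousLinearMap.mul ℝ ℂ) g.integrable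
  · exact Measurable.aestronglyMeasurable (by fun_prop)

instance (ξ : ℂ) : RightCommutative (conv ξ) := ⟨conv_right_comm ξ⟩

/-- The pointwise product of two causal functions. -/
def mul (f g : CausalFun) : CausalFun where
  toFun t := f t * g t
  measurable' := by fun_prop
  bounded' := ⟨f.bound * g.bound, fun t => by
    rw [norm_mul]
    exact mul_le_mul (f.norm_le_bound t) (g.norm_le_bound t) (norm_nonneg _)
      ((norm_nonneg _).trans (f.norm_le_bound t))⟩
  integrable' := g.integrable.bdd_mul f.measurable.aestronglyMeasurable
    (ae_of_all _ f.norm_le_bound)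
  zero_of_neg' t ht := by rw [f.zero_of_neg ht, zero_mul]

/-- The convolution product `F * ∏_{u ∈ B} H_u`. -/
def convFinset {V : Type*} (ξ : ℂ) (F : CausalFun) (H : V → CausalFun) (B : Finset V) :
    CausalFun := Multiset.foldl (conv ξ) F (B.val.map H)

lemma convFinset_empty {V : Type*} (ξ : ℂ) (F : CausalFun) (H : V → CausalFun) :
    convFinset ξ F H ∅ = F := rfl

lemma convFinset_insert {V : Type*} [DecidableEq V] (ξ : ℂ) (F : CausalFun) (H : V → CausalFun)
    {B : Finset V} {u : V} (hu : u ∉ B) :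
    convFinset ξ F H (insert u B) = conv ξ (convFinset ξ F H B) (H u) := by
  -- The order of folding is irrelevant, so u may be taken as the last factor.
  rw [convFinset, Finset.insert_val_of_notMem hu, Multiset.map_cons, ← Multiset.singleton_add,
    add_comm, Multiset.foldl_add]
  rfl

/-- Bridges two conventions: `convProd` folds from the right, `convFinset` from the left. -/
lemma conv_foldl (ξ : ℂ) (f g : CausalFun) (l : List CausalFun) :
    conv ξ f (l.foldl (conv ξ) g) = l.foldl (conv ξ) (conv ξ f g) := by
  induction l generalizing g with
  | nil => rfl
  | cons h l ih => rw [List.foldl_cons, List.foldl_cons, ih, conv_assoc]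

/-- The function `t ↦ P(t ξ)` on `[0, 1]`, extended by `0`. -/
def trunc {P : ℂ → ℂ} {U : Set ℂ} (hP : ContinuousOn P U) (hs : StarConvex ℝ 0 U) {ξ : ℂ}
    (hξ : ξ ∈ U) : CausalFun :=
  have hc : ContinuousOn (fun t : ℝ => P (t • ξ)) (Icc 0 1) :=
    hP.comp (f := fun t : ℝ => t • ξ) (by fun_prop) fun t ht => hs.smul_mem hξ ht.1 ht.2
  { toFun := (Icc 0 1).indicator fun t => P (t • ξ)
    measurable' := by
      classical
      rw [← piecewise_eq_indicator]
      exact hc.measurable_piecewise continuousOn_const measurableSet_Icc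
    bounded' := by
      obtain ⟨C, hC⟩ := isCompact_Icc.exists_bound_of_continuousOn hc
      refine ⟨max C 0, fun t => ?_⟩
      by_cases ht : t ∈ Icc (0 : ℝ) 1
      · rw [indicator_of_mem ht]
        exact (hC t ht).trans (le_max_left _ _)
      · rw [indicator_of_notMem ht, norm_zero]
        exact le_max_right _ _
    integrable' := (integrable_indicator_iff measurableSet_Icc).2
      (hc.integrableOn_compact isCompact_Icc)
    zero_of_neg' := fun t ht => indicator_of_notMem (fun h => not_lt.2 h.1 ht) _ }

/-- The causal function `k` describes `P` on the segment from `0` to `ξ`. -/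
def Represents (ξ : ℂ) (k : CausalFun) (P : ℂ → ℂ) : Prop :=
  ∀ t ∈ Icc (0 : ℝ) 1, P (t • ξ) = k t

variable {P Q : ℂ → ℂ} {ξ : ℂ} {k h : CausalFun}

lemma represents_trunc {U : Set ℂ} (hP : ContinuousOn P U) (hs : StarConvex ℝ 0 U)
    (hξ : ξ ∈ U) : Represents ξ (trunc hP hs hξ) P := fun _ ht =>
  (indicator_of_mem ht fun t : ℝ => P (t • ξ)).symm

lemma trunc_of_notMem {U : Set ℂ} (hP : ContinuousOn P U) (hs : StarConvex ℝ 0 U)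
    (hξ : ξ ∈ U) {t : ℝ} (ht : t ∉ Icc (0 : ℝ) 1) : trunc hP hs hξ t = 0 :=
  indicator_of_notMem ht fun t : ℝ => P (t • ξ)

/-- Both functions vanish on the negative axis, so the integral over the line is one over [0, t],
and x ↦ x t carries it to [0, 1]. Only arguments in [0, 1] occur, so nothing is assumed about k and
h beyond 1. -/
lemma Represents.conv (hk : Represents ξ k P) (hh : Represents ξ h Q) :
    Represents ξ (conv ξ k h) (Resurgence.conv P Q) := by
  intro t ht
  have h1 : ∫ x, k (t - x) * h x = ∫ x in (0 : ℝ)..t, k (t - x) * h x := by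
    rw [intervalIntegral.integral_of_le ht.1, ← integral_Icc_eq_integral_Ioc]
    refine (setIntegral_eq_integral_of_forall_compl_eq_zero fun x hx => ?_).symm
    rcases lt_or_ge x 0 with hx0 | hx0
    · rw [h.zero_of_neg hx0, mul_zero]
    · rw [k.zero_of_neg (by_contra fun h' => hx ⟨hx0, by linarith⟩), zero_mul]
  have h2 := intervalIntegral.smul_integral_comp_mul_right (a := 0) (b := 1)
    (fun x => k (t - x) * h x) t
  rw [zero_mul, one_mul] at h2
  rw [conv_apply, h1, ← h2, conv_eq, Complex.real_smul (x := t) (z := ∫ x in (0 : ℝ)..1, _),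
    ← intervalIntegral.integral_const_mul, ← intervalIntegral.integral_mul_const]
  refine intervalIntegral.integral_congr fun x hx => ?_
  rw [uIcc_of_le zero_le_one] at hx
  have hx1 : x * t ∈ Icc (0 : ℝ) 1 :=
    ⟨mul_nonneg hx.1 ht.1, mul_le_one₀ hx.2 ht.1 ht.2⟩
  have hx2 : t - x * t ∈ Icc (0 : ℝ) 1 :=
    ⟨by nlinarith [hx.2, ht.1], by linarith [hx1.1, ht.2]⟩
  have e1 := hk _ hx2
  have e2 := hh _ hx1
  rw [← e1, ← e2, smul_smul, smul_smul, Complex.real_smul (x := t)]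
  have : (1 - x) * t = t - x * t := by ring
  rw [this]
  ring

/-- The product `f * ∏^* g_i` is described by the corresponding product of causal functions. -/
lemma represents_convProd {ι : Type*} {g : ι → ℂ → ℂ} {H : ι → CausalFun} (l : List ι)
    (hk : Represents ξ k P) (hH : ∀ i ∈ l, Represents ξ (H i) (g i)) :
    Represents ξ ((l.map H).foldl (CausalFun.conv ξ) k)
      (convMul (0, P) (convProd (l.map g))).2 := by
  induction l generalizing k P with
  | nil =>
    intro t ht
    have : Resurgence.conv P (fun _ => 0) = 0 := by
      ext z
      simp [Resurgence.conv]
    simpa [convMul, convProd, delta, this] using hk t ht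
  | cons i l ih =>
    -- The induction hypothesis is used with g_i in the role of P: it describes g_i convolved with
    -- the remaining product, and associativity then absorbs P.
    have h1 := ih (hH i (by simp)) fun j hj => hH j (by simp [hj])
    have h2 := hk.conv h1
    rw [conv_foldl] at h2
    intro t ht
    rw [List.map_cons, List.map_cons, List.foldl_cons, ← h2 t ht]
    simp [convProd, convMul]

end CausalFun

open Function

/-! ### Integration over `Δ_T`, one variable at a time -/

/-- Fubini for ℝ^A × ℝ. Writing points as `updateFinset s A y` keeps one integrand on V → ℝ while A
shrinks. -/
lemma integral_updateFinset_union_singleton {V : Type*} [DecidableEq V] {A : Finset V} {u : V}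
    (hu : u ∉ A) (Ψ : (V → ℝ) → ℂ) (s : V → ℝ)
    (hi : Integrable fun y : ↥(A ∪ {u}) → ℝ => Ψ (updateFinset s (A ∪ {u}) y)) :
    ∫ y : ↥(A ∪ {u}) → ℝ, Ψ (updateFinset s (A ∪ {u}) y) =
      ∫ y : A → ℝ, ∫ x : ℝ, Ψ (update (updateFinset s A y) u x) := by
  have hd : Disjoint A {u} := Finset.disjoint_singleton_right.2 hu
  have hmp := volume_preserving_piFinsetUnion (fun _ : V => ℝ) hd
  have hi' := (hmp.integrable_comp_emb (MeasurableEquiv.measurableEmbedding _)).2 hi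
  rw [← hmp.integral_comp' (g := fun y => Ψ (updateFinset s (A ∪ {u}) y))]
  refine (integral_prod _ hi').trans (integral_congr_ae (ae_of_all _ fun y => ?_))
  have hmu := (volume_preserving_funUnique ({u} : Finset V) ℝ).symm
  refine (hmu.integral_comp' (g := fun z => Ψ (updateFinset s (A ∪ {u})
    (MeasurableEquiv.piFinsetUnion (fun _ => ℝ) hd (y, z))))).symm.trans ?_
  refine integral_congr_ae (ae_of_all _ fun x => ?_)
  dsimp only
  rw [update_updateFinset hu]
  rfl

namespace IterationDiagram

open CausalFun

variable {V : Type*} [Fintype V] [DecidableEq V] (T : IterationDiagram V)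

/-- The integrand after the variables outside of `A` have been integrated out. -/
def partialIntegrand (ξ : ℂ) (F G H : V → CausalFun) (A : Finset V) (s : V → ℝ) : ℂ :=
  ∏ v ∈ insert T.root A, G v (s v) *
    convFinset ξ (F v) H (T.children v \ A) (s v - ∑ u ∈ T.children v ∩ A, s u)

/-- The factors G_v(s_v) with v ∈ A are integrable in separate variables; all the others are
bounded, and G at the root is evaluated at a fixed point. -/
lemma integrable_partialIntegrand (ξ : ℂ) (F G H : V → CausalFun) {A : Finset V}
    (hA : T.root ∉ A) (s : V → ℝ) :
    Integrable fun y : A → ℝ => T.partialIntegrand ξ F G H A (updateFinset s A y) := by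
  have h1 : Integrable fun y : A → ℝ => ∏ v : A, G v (y v) :=
    Integrable.fintype_prod (f := fun v : A => (G v : ℝ → ℂ)) fun v => (G v).integrable
  set K : V → CausalFun := fun v => convFinset ξ (F v) H (T.children v \ A)
  have h2 : ∀ y : A → ℝ, T.partialIntegrand ξ F G H A (updateFinset s A y) =
      (G T.root (s T.root) * ∏ v ∈ insert T.root A, K v (updateFinset s A y v -
        ∑ u ∈ T.children v ∩ A, updateFinset s A y u)) * ∏ v : A, G v (y v) := by
    intro y
    have h3 : ∏ v : A, G v (y v) = ∏ v ∈ A, G v (updateFinset s A y v) := by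
      refine Eq.trans ?_ (Finset.prod_coe_sort A fun v => G v (updateFinset s A y v))
      exact Finset.prod_congr rfl fun v _ => by simp [updateFinset]
    rw [partialIntegrand, Finset.prod_mul_distrib, Finset.prod_insert hA, h3]
    simp only [updateFinset, hA, dif_neg, not_false_eq_true]
    ring
  simp_rw [h2]
  refine h1.bdd_mul (c := ‖G T.root (s T.root)‖ * ∏ v ∈ insert T.root A, (K v).bound) ?_
    (ae_of_all _ fun y => ?_)
  · have h4 : Measurable (updateFinset s A) := measurable_updateFinset
    refine Measurable.aestronglyMeasurable (Measurable.const_mul ?_ _)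
    refine Finset.measurable_fun_prod _ fun v _ => (K v).measurable.comp ?_
    refine ((measurable_pi_apply v).comp h4).sub ?_
    exact Finset.measurable_fun_sum _ fun u _ => (measurable_pi_apply u).comp h4
  · rw [norm_mul, norm_prod]
    refine mul_le_mul_of_nonneg_left ?_ (norm_nonneg _)
    exact Finset.prod_le_prod (fun _ _ => norm_nonneg _) fun v _ => (K v).norm_le_bound _

/-- Integrating out a vertex `u` without remaining incoming edges. -/
lemma integral_partialIntegrand_update (ξ : ℂ) {F G H : V → CausalFun}
    (hH : ∀ v, H v = (G v).mul (convFinset ξ (F v) H (T.children v))) {A : Finset V} {u p : V}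
    (hu : u ∉ A) (hur : u ≠ T.root) (hup : T.Adj u p) (hp : p ∈ insert T.root A)
    (hmin : ∀ v ∈ T.children u, v ∉ A ∪ {u}) (s : V → ℝ) :
    (∫ x : ℝ, T.partialIntegrand ξ F G H (A ∪ {u}) (update s u x)) * ξ =
      T.partialIntegrand ξ F G H A s := by
  set B := insert T.root A with hB
  have huB : u ∉ B := by simp [hB, hur, hu]
  have hins : insert T.root (A ∪ {u}) = insert u B := by
    ext; simp [hB]; tauto
  have hpu : p ≠ u := fun h => huB (h ▸ hp)
  -- All children of u have been integrated out already, so the factor of u is exactly H_u.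
  have huc : T.children u \ (A ∪ {u}) = T.children u := by
    rw [Finset.sdiff_eq_self_iff_disjoint, Finset.disjoint_left]
    exact hmin
  have huc' : T.children u ∩ (A ∪ {u}) = ∅ := by
    rw [← Finset.disjoint_iff_inter_eq_empty, Finset.disjoint_left]
    exact hmin
  have hsum : ∀ v (x : ℝ), ∑ w ∈ T.children v ∩ A, update s u x w =
      ∑ w ∈ T.children v ∩ A, s w := fun v x =>
    Finset.sum_congr rfl fun w hw => update_of_ne (by
      rintro rfl
      exact hu (Finset.mem_inter.1 hw).2) _ _
  -- The only edge out of u goes to p, so no factor besides those of u and p contains s_u.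
  have hother : ∀ v ∈ B.erase p, T.children v \ (A ∪ {u}) = T.children v \ A ∧
      T.children v ∩ (A ∪ {u}) = T.children v ∩ A := by
    intro v hv
    have huv : u ∉ T.children v := fun h =>
      (Finset.mem_erase.1 hv).1 (T.out_unique _ _ _ (T.mem_children.1 h) hup)
    constructor <;> ext w <;> by_cases hw : w = u <;> simp_all
  have hpc : T.children p \ A = insert u (T.children p \ (A ∪ {u})) := by
    have := T.mem_children.2 hup
    ext w; by_cases hw : w = u <;> simp_all
  have hpc' : T.children p ∩ (A ∪ {u}) = insert u (T.children p ∩ A) := by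
    have := T.mem_children.2 hup
    ext w; by_cases hw : w = u <;> simp_all
  set c := s p - ∑ w ∈ T.children p ∩ A, s w
  set K := convFinset ξ (F p) H (T.children p \ (A ∪ {u}))
  set R := ∏ v ∈ B.erase p, G v (s v) *
    convFinset ξ (F v) H (T.children v \ A) (s v - ∑ w ∈ T.children v ∩ A, s w)
  -- As a function of x = s_u the integrand is K(c - x) H_u(x) times a constant: its integral times
  -- ξ is the convolution of K with H_u at c.
  have h1 : ∀ x, T.partialIntegrand ξ F G H (A ∪ {u}) (update s u x) =
      K (c - x) * H u x * (G p (s p) * R) := by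
    intro x
    rw [partialIntegrand, hins, Finset.prod_insert huB, ← Finset.mul_prod_erase B _ hp, huc, huc',
      hpc', Finset.sum_insert (by simp [hu]), hsum, update_self, update_of_ne hpu,
      Finset.sum_empty, sub_zero]
    have h2 : ∏ v ∈ B.erase p, G v (update s u x v) *
        convFinset ξ (F v) H (T.children v \ (A ∪ {u})) (update s u x v -
          ∑ w ∈ T.children v ∩ (A ∪ {u}), update s u x w) = R := by
      refine Finset.prod_congr rfl fun v hv => ?_
      have hvu : v ≠ u := fun h => huB (h ▸ Finset.mem_of_mem_erase hv)
      rw [(hother v hv).1, (hother v hv).2, hsum, update_of_ne hvu]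
    have h3 : H u x = G u x * convFinset ξ (F u) H (T.children u) x := by
      conv_lhs => rw [hH u]
      rfl
    have h4 : s p - (x + ∑ w ∈ T.children p ∩ A, s w) = c - x := by
      simp only [c]; ring
    rw [h2, h3, h4]
    ring
  have h5 : T.partialIntegrand ξ F G H A s = G p (s p) * CausalFun.conv ξ K (H u) c * R := by
    rw [partialIntegrand, ← Finset.mul_prod_erase B _ hp, hpc, convFinset_insert _ _ _ (by simp)]
  simp_rw [h1]
  rw [h5, integral_mul_const, conv_apply]
  ring

/-- Induction on the size of A, taking away a vertex minimal for the edge relation. The condition on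
successors ensures that the factor which receives the convolution is still present. -/
lemma integral_partialIntegrand (ξ : ℂ) {F G H : V → CausalFun}
    (hH : ∀ v, H v = (G v).mul (convFinset ξ (F v) H (T.children v))) (A : Finset V)
    (hA : T.root ∉ A) (hup : ∀ u ∈ A, ∀ p, T.Adj u p → p ∈ insert T.root A) (s : V → ℝ) :
    (∫ y : A → ℝ, T.partialIntegrand ξ F G H A (updateFinset s A y)) * ξ ^ A.card =
      H T.root (s T.root) := by
  induction hn : A.card generalizing A with
  | zero =>
    rw [Finset.card_eq_zero] at hn
    subst hn
    have h1 : H T.root (s T.root) =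
        G T.root (s T.root) * convFinset ξ (F T.root) H (T.children T.root) (s T.root) := by
      conv_lhs => rw [hH T.root]
      rfl
    simp only [volume_pi, Measure.pi_of_empty (fun _ : (∅ : Finset V) => (volume : Measure ℝ)),
      integral_dirac, updateFinset_empty, pow_zero, mul_one]
    simp [partialIntegrand, h1]
  | succ m ih =>
    have hne : A.Nonempty := Finset.card_pos.1 (by omega)
    obtain ⟨u, huA, hmin⟩ := T.wellFounded_adj.has_min (A : Set V) hne
    obtain ⟨B, huB, rfl⟩ : ∃ B, u ∉ B ∧ A = B ∪ {u} :=
      ⟨A.erase u, by simp, by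
        rw [Finset.union_comm, ← Finset.insert_eq, Finset.insert_erase huA]⟩
    have hur : u ≠ T.root := fun h => hA (h ▸ huA)
    obtain ⟨p, hp⟩ : ∃ p, T.Adj u p := by
      rcases Relation.ReflTransGen.cases_head (T.reaches_root u) with h | ⟨p, hp, -⟩
      · exact absurd h hur
      · exact ⟨p, hp⟩
    have hmin' : ∀ v ∈ T.children u, v ∉ B ∪ {u} := fun v hv hvA =>
      hmin v hvA (T.mem_children.1 hv)
    have hB : ∀ v p, v ∈ B ∪ {u} → T.Adj v p → p ∈ insert T.root B := by
      intro v p hv hvp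
      have h1 := hup v hv p hvp
      have h2 : p ≠ u := by
        rintro rfl
        exact hmin v hv hvp
      simpa [h2] using h1
    have hcard : B.card = m := by
      rw [Finset.card_union_of_disjoint (by simpa using huB)] at hn
      simpa using hn
    rw [integral_updateFinset_union_singleton huB _ _
      (T.integrable_partialIntegrand ξ F G H hA s), pow_succ', ← mul_assoc, ← integral_mul_const]
    simp_rw [T.integral_partialIntegrand_update ξ hH huB hur hp (hB u p huA hp) hmin']
    exact ih B (fun h => hA (Finset.mem_union_left _ h))
      (fun v hv p hvp => hB v p (Finset.mem_union_left _ hv) hvp) hcard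

end IterationDiagram

/-! ### From integrals over ℝ^{V°} to integrals over Δ_T -/

namespace IterationDiagram

open CausalFun

variable {V : Type*} [Fintype V] (T : IterationDiagram V)

section Coordinates

variable [DecidableEq V]

/-- The non-root vertices, as elements of a finite set. -/
def nonRootEquiv : T.NonRoot ≃ ↥(Finset.univ.erase T.root) :=
  Equiv.subtypeEquivRight fun v => by simp

/-- The background value 1 survives only at the root, where it is the normalization s_root = 1 of
Δ_T. -/
lemma updateFinset_piCongrLeft (s : T.NonRoot → ℝ) :
    updateFinset (fun _ => 1) (Finset.univ.erase T.root)
      (MeasurableEquiv.piCongrLeft (fun _ => ℝ) T.nonRootEquiv s) = T.withRoot s := by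
  ext v
  by_cases hv : v = T.root
  · subst hv
    simp [updateFinset, withRoot]
  · have h1 : v ∈ Finset.univ.erase T.root := by simp [hv]
    have h2 : (⟨v, h1⟩ : ↥(Finset.univ.erase T.root)) = T.nonRootEquiv ⟨v, hv⟩ := rfl
    simp only [updateFinset, h1, dif_pos, withRoot, ne_eq, hv, not_false_eq_true]
    rw [h2, MeasurableEquiv.coe_piCongrLeft, Equiv.piCongrLeft_apply_apply]

lemma card_nonRoot {n : ℕ} (e : Fin n ≃ T.NonRoot) : (Finset.univ.erase T.root).card = n := by
  have := Fintype.card_congr (e.trans T.nonRootEquiv)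
  simpa using this.symm

/-- The root is nobody's child, so when all other variables are present every convolution product
over integrated children is empty. -/
lemma partialIntegrand_nonRoot (ξ : ℂ) (F G H : V → CausalFun) (s : V → ℝ) :
    T.partialIntegrand ξ F G H (Finset.univ.erase T.root) s =
      ∏ v, G v (s v) * F v (s v - ∑ u ∈ T.children v, s u) := by
  have hroot : ∀ v, T.root ∉ T.children v := fun v hv =>
    T.not_adj_root v (T.mem_children.1 hv)
  rw [partialIntegrand, Finset.insert_erase (Finset.mem_univ _)]
  refine Finset.prod_congr rfl fun v _ => ?_
  have h1 : T.children v \ Finset.univ.erase T.root = ∅ := by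
    ext u
    simp only [Finset.mem_sdiff, Finset.mem_erase, Finset.mem_univ, and_true, not_not,
      Finset.notMem_empty, iff_false, not_and]
    rintro hu rfl
    exact hroot v hu
  have h2 : T.children v ∩ Finset.univ.erase T.root = T.children v := by
    rw [Finset.inter_erase, Finset.inter_univ, Finset.erase_eq_of_notMem (hroot v)]
  rw [h1, h2, convFinset_empty]

/-- The iterated convolution as an integral, for functions on the line. -/
lemma integral_withRoot (ξ : ℂ) {F G H : V → CausalFun} {n : ℕ} (e : Fin n ≃ T.NonRoot)
    (hH : ∀ v, H v = (G v).mul (convFinset ξ (F v) H (T.children v))) :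
    (Integrable fun s : T.NonRoot → ℝ => ∏ v, G v (T.withRoot s v) *
        F v (T.withRoot s v - ∑ u ∈ T.children v, T.withRoot s u)) ∧
      (∫ s : T.NonRoot → ℝ, ∏ v, G v (T.withRoot s v) *
        F v (T.withRoot s v - ∑ u ∈ T.children v, T.withRoot s u)) * ξ ^ n = H T.root 1 := by
  have hmp := volume_measurePreserving_piCongrLeft
    (fun _ : ↥(Finset.univ.erase T.root) => ℝ) T.nonRootEquiv
  have h1 := T.integrable_partialIntegrand ξ F G H (Finset.notMem_erase T.root Finset.univ)
    (fun _ => 1)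
  have h2 := T.integral_partialIntegrand ξ hH _ (Finset.notMem_erase T.root Finset.univ)
    (fun _ _ p _ => by simp [Finset.insert_erase]) (fun _ => 1)
  have h1' := (hmp.integrable_comp_emb (MeasurableEquiv.measurableEmbedding _)).2 h1
  rw [← hmp.integral_comp', T.card_nonRoot e] at h2
  simp only [comp_def, updateFinset_piCongrLeft, partialIntegrand_nonRoot] at h1' h2
  exact ⟨h1', h2⟩

end Coordinates

variable {f P : V → ℂ → ℂ} {U : Set ℂ} (hU : IsOpen U) (hs : StarConvex ℝ 0 U)
  (hf : ∀ v, DifferentiableOn ℂ (f v) U) (hP : ∀ v, DifferentiableOn ℂ (P v) U)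

include hU hs hf hP in
/-- The iterated convolution as an integral over `Δ_T`. -/
lemma psi_root_eq_integral {n : ℕ} (e : Fin n ≃ T.NonRoot) {ξ : ℂ} (hξ : ξ ∈ U) :
    IntegrableOn (fun s => (∏ v, P v (T.withRoot s v • ξ) *
        f v ((T.withRoot s v - ∑ u ∈ T.children v, T.withRoot s u) • ξ)) * ξ ^ n)
      T.simplexCoords ∧
    T.psi f P T.root ξ = ∫ s in T.simplexCoords, (∏ v, P v (T.withRoot s v • ξ) *
        f v ((T.withRoot s v - ∑ u ∈ T.children v, T.withRoot s u) • ξ)) * ξ ^ n := by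
  classical
  have hpsi : ∀ v, ContinuousOn (T.psi f P v) U := fun v =>
    (T.differentiableOn_psi hU hs hf hP v).continuousOn
  let F : V → CausalFun := fun v => trunc (hf v).continuousOn hs hξ
  let G : V → CausalFun := fun v => trunc (hP v).continuousOn hs hξ
  let H : V → CausalFun := fun v => trunc (hpsi v) hs hξ
  have hF : ∀ v, Represents ξ (F v) (f v) := fun v => represents_trunc _ hs hξ
  have hG : ∀ v, Represents ξ (G v) (P v) := fun v => represents_trunc _ hs hξ
  have hHr : ∀ v, Represents ξ (H v) (T.psi f P v) := fun v => represents_trunc _ hs hξ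
  have hH : ∀ v, H v = (G v).mul (convFinset ξ (F v) H (T.children v)) := by
    intro v
    ext t
    change H v t = G v t * convFinset ξ (F v) H (T.children v) t
    -- On [0, 1] this is the recursion for ψ. The convolution of truncated functions need not vanish
    -- beyond 1, but there the cut-off in G_v makes both sides 0.
    by_cases ht : t ∈ Icc (0 : ℝ) 1
    · have h1 := represents_convProd (T.children v).toList (hF v) (fun u _ => hHr u) t ht
      have h2 : convFinset ξ (F v) H (T.children v) =
          ((T.children v).toList.map H).foldl (CausalFun.conv ξ) (F v) := by
        rw [convFinset, ← Finset.coe_toList, Multiset.map_coe, Multiset.coe_foldl]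
      rw [← hHr v t ht, psi_eq, h2, ← h1, ← hG v t ht]
    · rw [show H v t = 0 from trunc_of_notMem _ hs hξ ht,
        show G v t = 0 from trunc_of_notMem _ hs hξ ht, zero_mul]
  obtain ⟨h1, h2⟩ := T.integral_withRoot ξ e hH
  set g : (T.NonRoot → ℝ) → ℂ := fun s => ∏ v, G v (T.withRoot s v) *
        F v (T.withRoot s v - ∑ u ∈ T.children v, T.withRoot s u)
  have hmem : ∀ s ∈ T.simplexCoords, g s * ξ ^ n = (∏ v, P v (T.withRoot s v • ξ) *
        f v ((T.withRoot s v - ∑ u ∈ T.children v, T.withRoot s u) • ξ)) * ξ ^ n := by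
    intro s hs'
    refine congrArg (· * ξ ^ n) (Finset.prod_congr rfl fun v _ => ?_)
    have h3 := simplex_le_one hs' v
    have h4 : 0 ≤ ∑ u ∈ T.children v, T.withRoot s u := Finset.sum_nonneg fun u _ => hs'.1 u
    rw [hG v _ ⟨hs'.1 v, h3⟩, hF v _ ⟨sub_nonneg.2 (hs'.2.1 v), by linarith⟩]
  -- The supports cut out Δ_T: G_v vanishes where s_v < 0, and F_v where s_v is less than the sum
  -- over the children. The cut-offs at 1 remove nothing, as all arguments are at most 1 on Δ_T.
  have hnotMem : ∀ s, s ∉ T.simplexCoords → g s * ξ ^ n = 0 := by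
    intro s hs'
    by_contra hne
    have hne' := Finset.prod_ne_zero_iff.1 (left_ne_zero_of_mul hne)
    refine hs' ⟨fun v => ?_, fun v => ?_, T.withRoot_root s⟩
    · by_contra hlt
      exact left_ne_zero_of_mul (hne' v (Finset.mem_univ v)) ((G v).zero_of_neg (not_le.1 hlt))
    · by_contra hlt
      exact right_ne_zero_of_mul (hne' v (Finset.mem_univ v))
        ((F v).zero_of_neg (sub_neg.2 (not_le.1 hlt)))
  constructor
  · exact (h1.mul_const (ξ ^ n)).integrableOn.congr_fun hmem T.measurableSet_simplexCoords
  · have h3 := hHr T.root 1 ⟨zero_le_one, le_rfl⟩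
    rw [one_smul] at h3
    rw [h3, ← h2, ← integral_mul_const,
      ← setIntegral_eq_integral_of_forall_compl_eq_zero hnotMem]
    exact setIntegral_congr_fun T.measurableSet_simplexCoords hmem

end IterationDiagram

end Resurgence

end

/-! ### The integral formula for the iterated convolution -/

open Resurgence in
theorem proposition3p7 {V : Type*} [Fintype V] (T : IterationDiagram V) (Ω : DFS)
    (f φ : V → ℂ → ℂ) (hf : ∀ v, Differentiable ℂ (f v))
    (hφ : ∀ v, IsContinuable (T.omegaAt Ω v) (φ v)) {n : ℕ} (e : Fin n ≃ T.NonRoot) :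
    (∀ v, IsHolomorphicPullback (T.omegaAt Ω v) (φ v) (pullbackGerm (T.omegaAt Ω v) (φ v))) ∧
    IsHolomorphicForm (T.betaForm Ω e f φ) ∧
    ∃ Ψ : ℂ → ℂ, DifferentiableOn ℂ Ψ Ω.disc ∧ Ψ =ᶠ[𝓝 0] T.iteratedConv f φ ∧
      ∀ ξ ∈ Ω.disc,
        MeasureTheory.IntegrableOn
          (T.coefficient e ((T.toRealForm Ω (T.betaForm Ω e f φ)).pullback (T.D Ω ξ)))
          T.simplexCoords ∧
        Ψ ξ = pushforward (T.D Ω ξ) (T.integrationCurrent e)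
          (T.toRealForm Ω (T.betaForm Ω e f φ)) := by
  have hpb := fun v => (hφ v).isHolomorphicPullback_pullbackGerm
  refine ⟨hpb, T.isHolomorphicForm_betaForm Ω e hf hpb, ?_⟩
  set P : V → ℂ → ℂ := fun v => discExtension (T.omegaAt Ω v) (φ v)
  have hP : ∀ v, DifferentiableOn ℂ (P v) Ω.disc := fun v =>
    (hpb v).differentiableOn_discExtension.mono (Ω.disc_subset_disc_nsum _)
  have hf' : ∀ v, DifferentiableOn ℂ (f v) Ω.disc := fun v => (hf v).differentiableOn
  -- The representatives φ_v are arbitrary away from 0, so the extension is built from the P_v,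
  -- which are holomorphic on the whole disc.
  refine ⟨T.psi f P T.root, T.differentiableOn_psi Ω.isOpen_disc Ω.starConvex_disc hf' hP _,
    ?_, fun ξ hξ => ?_⟩
  · have h1 : ∀ᶠ z in 𝓝 (0 : ℂ), ∀ v, P v z = φ v z :=
      eventually_all.2 fun v => (hpb v).discExtension_eventuallyEq
    -- As V is finite, P_v = φ_v holds on one disc for all v, and discs are star-shaped.
    obtain ⟨r, hr, hb⟩ := Metric.eventually_nhds_iff_ball.1 h1
    have hstar : StarConvex ℝ 0 (Metric.ball (0 : ℂ) r) :=
      (convex_ball (0 : ℂ) r).starConvex (Metric.mem_ball_self hr)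
    exact (T.psi_congr f hstar (fun v z hz => hb z hz v) T.root).eventuallyEq_of_mem
      (Metric.ball_mem_nhds 0 hr)
  · obtain ⟨h1, h2⟩ := T.psi_root_eq_integral Ω.isOpen_disc Ω.starConvex_disc hf' hP e hξ
    have h3 : EqOn _ (T.coefficient e ((T.toRealForm Ω (T.betaForm Ω e f φ)).pullback (T.D Ω ξ)))
      T.simplexCoords := fun s hs => (T.coefficient_pullback_D e f φ hξ hs).symm
    exact ⟨h1.congr_fun h3 T.measurableSet_simplexCoords,
      h2.trans (MeasureTheory.setIntegral_congr_fun T.measurableSet_simplexCoords h3)⟩
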